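/- Let $\mathcal A$ be the algebra of differential polynomials in one dependent variable $u(x)$, i.e. polynomials in $u_x,u_{xx},\dots$ whose coefficients are smooth functions of $u$, graded by $\deg f(u)=0$, $\deg u^{(k)}=k$. Let $P_1=\delta'(x-y)$ and $P_2^{(0)}=u\,\delta'(x-y)+\tfrac12u_x\,\delta(x-y)$. For a local bivector $P$, regarded as a differential operator, and a local functional $I=\int f\,dx$ put $d_PI=P(\delta I/\delta u)$, and for a vector field $X$ put $d_PX=\mathrm{Lie}_XP$; write $d_1=d_{P_1}$ and $d_2=d_{P_2^{(0)}}$. For vector fields let $[V,W]=\sum_s\big((\partial_x^sV)\,\partial W/\partial u^{(s)}-(\partial_x^sW)\,\partial V/\partial u^{(s)}\big)$. A quasi-Miura transformation is $u\mapsto\bar u=\sum_k\epsilon^kF_k/G_k$ with $F_k,G_k\in\mathcal A$, $\deg F_k-\deg G_k=k$ and $\partial(F_0/G_0)/\partial u\ne0$. Let $s(u)$ be a smooth function, $X^{(2)}=s\,u_{xx}+s'u_x^2$, let $X^{(4)}\in\mathcal A$ be homogeneous of degree $4$, and suppose that $$P_1=\delta'(x-y),\qquad P_2=P_2^{(0)}+\epsilon^2P_2^{(2)}+\epsilon^4P_2^{(4)}+O(\epsilon^5),\qquad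 P_2^{(2)}=d_1X^{(2)},\quad P_2^{(4)}=d_1X^{(4)},$$ is a deformation of order four, i.e. the Schouten brackets $[P_1,P_1]$, $[P_2,P_2]$, $[P_1,P_2]$ are $o(\epsilon^4)$. Then the deformation is quasi-trivial: some quasi-Miura transformation takes $(P_1,P_2)$ to $\big(\delta'(x-y),\ \bar u\,\delta'(x-y)+\tfrac12\bar u_x\,\delta(x-y)\big)$ up to $O(\epsilon^5)$. More precisely, for every $u_0$ let $b(u)=-\tfrac23\int_{u_0}^us(t)\,dt$, $B=\int b(u)\frac{u_{xx}}{u_x}\,dx$ and $$\rho=-\tfrac34\,b'b''\,\frac{u_{xx}^2}{u_x}+\tfrac75\,(b')^2\,\frac{u_{xx}^3}{u_x^3}-\tfrac32\,(b')^2\,\frac{u_{xx}u_{xxx}}{u_x^2}.$$ There are $\alpha,\beta\in\mathcal A$, homogeneous of degree $3$, such that for $\tilde A=\int(-u\rho+\alpha)\,dx$ and $\tilde B=\int(\rho+\beta)\,dx$ $$X^{(4)}=d_1\tilde A+d_2\tilde B-\tfrac12[d_1B,d_2B].$$ Moreover, with $X=-d_1B$ and $Y=-d_1\tilde B$, $$\mathrm{Lie}_XP_1=0,\quad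 \mathrm{Lie}_XP_2^{(0)}=P_2^{(2)},\quad \mathrm{Lie}_YP_1=0,\quad P_2^{(4)}-\tfrac12\mathrm{Lie}_X^2P_2^{(0)}=\mathrm{Lie}_YP_2^{(0)},$$ and the deformation is eliminated in two steps: the quasi-Miura transformation $u\mapsto\exp(\epsilon^2X)u$ preserves $P_1$ and reduces $P_2$ to $P_2^{(0)}+\epsilon^4\big(P_2^{(4)}-\tfrac12\mathrm{Lie}_X^2P_2^{(0)}\big)$, and then the quasi-Miura transformation $u\mapsto\exp(\epsilon^4Y)u$ preserves $P_1$ and reduces the latter to $P_2^{(0)}$, all up to $O(\epsilon^5)$. -/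

import Mathlib

open scoped ContDiff nonZeroDivisors

noncomputable section

namespace LoopSpace

/-! ## Differential polynomials and their ratios -/

/-- Smooth functions of the dependent variable `u`. -/
def SmoothFun : Subalgebra ℝ (ℝ → ℝ) where
  carrier := {f | ContDiff ℝ ∞ f}
  mul_mem' {f g} hf hg := by
    have h1 : ContDiff ℝ ∞ f := hf
    have h2 : ContDiff ℝ ∞ g := hg
    exact h1.mul h2
  add_mem' {f g} hf hg := by
    have h1 : ContDiff ℝ ∞ f := hf
    have h2 : ContDiff ℝ ∞ g := hg
    exact h1.add h2
  algebraMap_mem' c := by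
    change ContDiff ℝ ∞ fun _ : ℝ => c
    exact contDiff_const

/-- The derivative `d/du` on smooth functions of `u`. -/
def derivFun : Derivation ℝ SmoothFun SmoothFun :=
  Derivation.mk'
    { toFun := fun f => ⟨deriv f.1, (contDiff_infty_iff_deriv.1 f.2).2⟩
      map_add' := fun f g => by
        ext x
        exact deriv_add ((contDiff_infty_iff_deriv.1 f.2).1 x)
          ((contDiff_infty_iff_deriv.1 g.2).1 x)
      map_smul' := fun c f => by
        ext x
        exact deriv_const_smul c ((contDiff_infty_iff_deriv.1 f.2).1 x) }
    (fun f g => by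
      ext x
      have h := deriv_mul ((contDiff_infty_iff_deriv.1 f.2).1 x)
        ((contDiff_infty_iff_deriv.1 g.2).1 x)
      change deriv (f.1 * g.1) x = f.1 x * deriv g.1 x + g.1 x * deriv f.1 x
      rw [h]
      ring)

/-- The primitive `u ↦ ∫_{u₀}^{u} s(t) dt` of a smooth function. -/
def primitive (u₀ : ℝ) (s : SmoothFun) : SmoothFun :=
  ⟨fun x => ∫ t in u₀..x, s.1 t, by
    have hs : ContDiff ℝ ∞ s.1 := s.2
    have hc : Continuous s.1 := hs.continuous
    have hd : ∀ x, HasDerivAt (fun y => ∫ t in u₀..y, s.1 t) (s.1 x) x := fun x =>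
      intervalIntegral.integral_hasDerivAt_right (hc.intervalIntegrable _ _)
        hc.stronglyMeasurable.stronglyMeasurableAtFilter hc.continuousAt
    change ContDiff ℝ ∞ (fun x => ∫ t in u₀..x, s.1 t)
    refine contDiff_infty_iff_deriv.2 ⟨fun x => (hd x).differentiableAt, ?_⟩
    have h : deriv (fun y => ∫ t in u₀..y, s.1 t) = s.1 := funext fun x => (hd x).deriv
    rw [h]
    exact hs⟩

/-- The algebra of differential polynomials: polynomials in `u_x, u_xx, …` whose coefficients are
smooth functions of `u`. The polynomial variable of index `n` is `u^{(n+1)}`. -/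
abbrev DiffPoly : Type := MvPolynomial ℕ SmoothFun

/-- The gradation: `deg f(u) = 0`, `deg u^{(k)} = k`. -/
def jetDegree (n : ℕ) : ℕ := n + 1

/-- Ratios `F / G` of differential polynomials (`G` not a zero divisor). -/
def DiffRat : Type := FractionRing DiffPoly

instance : CommRing DiffRat := inferInstanceAs (CommRing (FractionRing DiffPoly))

instance : Algebra DiffPoly DiffRat := inferInstanceAs (Algebra DiffPoly (FractionRing DiffPoly))

instance : Algebra ℝ DiffRat := inferInstanceAs (Algebra ℝ (FractionRing DiffPoly))

instance : IsScalarTower ℝ DiffPoly DiffRat :=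
  inferInstanceAs (IsScalarTower ℝ DiffPoly (FractionRing DiffPoly))

instance : IsLocalization DiffPoly⁰ DiffRat :=
  inferInstanceAs (IsLocalization DiffPoly⁰ (FractionRing DiffPoly))

/-- A smooth function of `u`, seen as a differential function. -/
def fn (f : SmoothFun) : DiffRat := algebraMap DiffPoly DiffRat (MvPolynomial.C f)

/-- The jet variable `u^{(s)}`, with `u^{(0)} = u`. -/
def jet : ℕ → DiffRat
  | 0 => fn ⟨fun x => x, show ContDiff ℝ ∞ fun x : ℝ => x from contDiff_id⟩
  | n + 1 => algebraMap DiffPoly DiffRat (MvPolynomial.X n)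

lemma X_mem_nonZeroDivisors (n : ℕ) : (MvPolynomial.X n : DiffPoly) ∈ DiffPoly⁰ :=
  MvPolynomial.isRegular_X.mem_nonZeroDivisors

/-- The ratio `1 / u_x`. -/
def uxInv : DiffRat := IsLocalization.mk' DiffRat (1 : DiffPoly)
  (⟨MvPolynomial.X 0, X_mem_nonZeroDivisors 0⟩ : DiffPoly⁰)

lemma jet_one_mul_uxInv : jet 1 * uxInv = 1 := by
  simp only [jet, uxInv]
  rw [IsLocalization.mul_mk'_eq_mk'_of_mul, mul_one]
  exact IsLocalization.mk'_self DiffRat _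

/-- `q` is a ratio `F / G` of homogeneous differential polynomials with `deg F - deg G = k`. -/
def HasDegree (q : DiffRat) (k : ℕ) : Prop :=
  ∃ (F G : DiffPoly) (hG : G ∈ DiffPoly⁰) (m : ℕ),
    F.IsWeightedHomogeneous jetDegree (m + k) ∧ G.IsWeightedHomogeneous jetDegree m ∧
      q = IsLocalization.mk' DiffRat F ⟨G, hG⟩

/-! ## Partial derivatives -/

lemma coeff_sum_derivFun (p : DiffPoly) (m : ℕ →₀ ℕ) :
    (∑ n ∈ p.support, MvPolynomial.monomial n (derivFun (p.coeff n))).coeff m =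
      derivFun (p.coeff m) := by
  classical
  rw [MvPolynomial.coeff_sum]
  simp only [MvPolynomial.coeff_monomial]
  rw [Finset.sum_ite_eq' p.support m]
  split_ifs with h
  · rfl
  · rw [MvPolynomial.notMem_support_iff.1 h, map_zero]

/-- `∂/∂u` on differential polynomials, as a linear map: it differentiates the coefficients. -/
def coeffDerivLin : DiffPoly →ₗ[ℝ] DiffPoly where
  toFun p := ∑ n ∈ p.support, MvPolynomial.monomial n (derivFun (p.coeff n))
  map_add' p q := by
    ext1 m
    rw [MvPolynomial.coeff_add]
    simp only [coeff_sum_derivFun]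
    rw [MvPolynomial.coeff_add, map_add]
  map_smul' c p := by
    ext1 m
    rw [RingHom.id_apply, MvPolynomial.coeff_smul]
    simp only [coeff_sum_derivFun]
    rw [MvPolynomial.coeff_smul, Derivation.map_smul]

lemma coeffDerivLin_apply (p : DiffPoly) : coeffDerivLin p =
    ∑ n ∈ p.support, MvPolynomial.monomial n (derivFun (p.coeff n)) := rfl

lemma coeffDerivLin_monomial (m : ℕ →₀ ℕ) (c : SmoothFun) :
    coeffDerivLin (MvPolynomial.monomial m c) = MvPolynomial.monomial m (derivFun c) := by
  classical
  ext1 n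
  rw [coeffDerivLin_apply, coeff_sum_derivFun, MvPolynomial.coeff_monomial, MvPolynomial.coeff_monomial]
  split_ifs <;> simp

lemma coeffDerivLin_mul (p q : DiffPoly) :
    coeffDerivLin (p * q) = p * coeffDerivLin q + q * coeffDerivLin p := by
  induction p using MvPolynomial.induction_on' with
  | add p₁ p₂ h₁ h₂ =>
    simp only [add_mul, mul_add, map_add, h₁, h₂]
    ring
  | monomial m c =>
    induction q using MvPolynomial.induction_on' with
    | add q₁ q₂ h₁ h₂ =>
      simp only [add_mul, mul_add, map_add, h₁, h₂]
      ring
    | monomial n d =>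
      rw [MvPolynomial.monomial_mul]
      simp only [coeffDerivLin_monomial, MvPolynomial.monomial_mul, Derivation.leibniz,
        smul_eq_mul]
      rw [add_comm n m, ← map_add]

/-- `∂/∂u` on differential polynomials, as a derivation. -/
def coeffDeriv : Derivation ℝ DiffPoly DiffPoly where
  toLinearMap := coeffDerivLin
  map_one_eq_zero' := by
    rw [show (1 : DiffPoly) = MvPolynomial.monomial 0 1 from rfl]
    refine (coeffDerivLin_monomial 0 1).trans ?_
    simp
  leibniz' p q := coeffDerivLin_mul p q

/-- The partial derivatives `∂/∂u^{(s)}` on differential polynomials. -/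
def partialPoly : ℕ → Derivation ℝ DiffPoly DiffPoly
  | 0 => coeffDeriv
  | n + 1 => (MvPolynomial.pderiv n).restrictScalars ℝ

/-- The extension of a derivation of a ring to its total ring of fractions
(the quotient rule). -/
def extendDer {A : Type} (K : Type) [CommRing A] [CommRing K] [Algebra A K] [Algebra ℝ A]
    [Algebra ℝ K] [IsScalarTower ℝ A K] [IsLocalization A⁰ K] (d : Derivation ℝ A A) :
    Derivation ℝ K K :=
  haveI : Algebra.FormallyEtale A K := Algebra.FormallyEtale.of_isLocalization A⁰
  ((((Algebra.linearMap A K) ∘ₗ d.liftKaehlerDifferential).liftBaseChange K) ∘ₗ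
    (KaehlerDifferential.tensorKaehlerEquivOfFormallyEtale ℝ A K).symm.toLinearMap).compDer
      (KaehlerDifferential.D ℝ K)

lemma extendDer_algebraMap {A : Type} (K : Type) [CommRing A] [CommRing K] [Algebra A K]
    [Algebra ℝ A] [Algebra ℝ K] [IsScalarTower ℝ A K] [IsLocalization A⁰ K]
    (d : Derivation ℝ A A) (p : A) :
    extendDer K d (algebraMap A K p) = algebraMap A K (d p) := by
  have : Algebra.FormallyEtale A K := Algebra.FormallyEtale.of_isLocalization A⁰
  simp [extendDer, KaehlerDifferential.tensorKaehlerEquivOfFormallyEtale_symm_D_algebraMap]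

/-- The partial derivatives `∂/∂u^{(s)}` on ratios of differential polynomials. -/
def partialD (s : ℕ) : Derivation ℝ DiffRat DiffRat := extendDer (A := DiffPoly) DiffRat (partialPoly s)

lemma partialD_algebraMap (s : ℕ) (p : DiffPoly) :
    partialD s (algebraMap DiffPoly DiffRat p) = algebraMap DiffPoly DiffRat (partialPoly s p) :=
  extendDer_algebraMap (A := DiffPoly) DiffRat _ _

/-- A differential polynomial depends on finitely many jet variables. -/
lemma finite_partialPoly (p : DiffPoly) : {s | partialPoly s p ≠ 0}.Finite := by
  classical
  refine (((p.vars.image Nat.succ) ∪ {0}).finite_toSet).subset fun s hs => ?_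
  cases s with
  | zero => simp
  | succ n =>
    by_contra h
    refine hs ?_
    have hn : n ∉ p.vars := fun hv => h (by simp [hv])
    exact MvPolynomial.pderiv_eq_zero_of_notMem_vars hn

/-- A ratio of differential polynomials depends on finitely many jet variables. -/
lemma finite_partialD (q : DiffRat) : {s | partialD s q ≠ 0}.Finite := by
  obtain ⟨a, g, rfl⟩ := IsLocalization.exists_mk'_eq DiffPoly⁰ q
  refine ((finite_partialPoly a).union (finite_partialPoly g)).subset fun s hs => ?_
  by_contra h
  simp only [Set.mem_union, Set.mem_ofPred_eq, not_or, not_not] at h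
  refine hs ?_
  have hu : IsUnit (algebraMap DiffPoly DiffRat g) := IsLocalization.map_units DiffRat g
  have h1 := congrArg (partialD s) (IsLocalization.mk'_spec DiffRat a g)
  rw [Derivation.leibniz, partialD_algebraMap, partialD_algebraMap, h.1, h.2, map_zero] at h1
  rw [smul_zero, zero_add, smul_eq_mul] at h1
  exact (hu.mul_right_eq_zero).1 h1

lemma finite_support_mul_partialD (c : ℕ → DiffRat) (f : DiffRat) :
    (Function.support fun s => c s * partialD s f).Finite :=
  (finite_partialD f).subset fun s hs h => hs (by simp [h])

/-! ## Vector fields, the total derivative, variational derivatives -/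

/-- The derivation `∑_s c_s ∂/∂u^{(s)}`. -/
def vecField (c : ℕ → DiffRat) : Derivation ℝ DiffRat DiffRat :=
  Derivation.mk'
    { toFun := fun f => ∑ᶠ s, c s * partialD s f
      map_add' := fun f g => by
        rw [← finsum_add_distrib (finite_support_mul_partialD c f)
          (finite_support_mul_partialD c g)]
        simp only [map_add, mul_add]
      map_smul' := fun r f => by
        rw [RingHom.id_apply, smul_finsum' r (finite_support_mul_partialD c f)]
        simp only [Derivation.map_smul, mul_smul_comm] }
    (fun f g => by
      change (∑ᶠ s, c s * partialD s (f * g)) =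
        f * (∑ᶠ s, c s * partialD s g) + g * (∑ᶠ s, c s * partialD s f)
      have hf := finite_support_mul_partialD c f
      have hg := finite_support_mul_partialD c g
      rw [mul_finsum' _ _ hg, mul_finsum' _ _ hf, ← finsum_add_distrib
        (hg.subset fun s hs h => hs (by simp [h])) (hf.subset fun s hs h => hs (by simp [h]))]
      refine finsum_congr fun s => ?_
      rw [Derivation.leibniz, smul_eq_mul, smul_eq_mul]
      ring)

/-- The total derivative `∂_x = ∑_s u^{(s+1)} ∂/∂u^{(s)}`. -/
def totalD : Derivation ℝ DiffRat DiffRat := vecField fun s => jet (s + 1)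

/-- The powers `∂_x^n`. -/
def dPow (n : ℕ) : Module.End ℝ DiffRat := (totalD : DiffRat →ₗ[ℝ] DiffRat) ^ n

/-- The derivative along the translation invariant vector field with component `v`:
`∑_s (∂_x^s v) ∂/∂u^{(s)}`. -/
def along (v : DiffRat) : Derivation ℝ DiffRat DiffRat := vecField fun s => dPow s v

/-- The Fréchet derivative `v_* = ∑_s (∂v/∂u^{(s)}) ∂_x^s`. -/
def frechet (v : DiffRat) : Module.End ℝ DiffRat where
  toFun f := ∑ᶠ s, partialD s v * dPow s f
  map_add' f g := by
    rw [← finsum_add_distrib]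
    · simp only [map_add, mul_add]
    all_goals exact (finite_partialD v).subset fun s hs h => hs (by simp [h])
  map_smul' r f := by
    rw [RingHom.id_apply, smul_finsum' r]
    · simp only [map_smul, mul_smul_comm]
    · exact (finite_partialD v).subset fun s hs h => hs (by simp [h])

/-- The formal adjoint `v_*† = ∑_s (-∂_x)^s ∘ (∂v/∂u^{(s)})` of the Fréchet derivative. -/
def frechetAdj (v : DiffRat) : Module.End ℝ DiffRat where
  toFun f := ∑ᶠ s, (-1 : ℝ) ^ s • dPow s (partialD s v * f)
  map_add' f g := by
    rw [← finsum_add_distrib]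
    · simp only [map_add, mul_add, smul_add]
    all_goals exact (finite_partialD v).subset fun s hs h => hs (by simp [h])
  map_smul' r f := by
    rw [RingHom.id_apply, smul_finsum' r]
    · simp only [map_smul, mul_smul_comm, smul_comm r]
    · exact (finite_partialD v).subset fun s hs h => hs (by simp [h])

/-- The variational derivative `δI/δu = ∑_s (-∂_x)^s (∂f/∂u^{(s)})` of the local functional
`I = ∫ f dx`. -/
def varDeriv (f : DiffRat) : DiffRat := ∑ᶠ s, (-1 : ℝ) ^ s • dPow s (partialD s f)

/-- The Schouten bracket of two vector fields, i.e. their commutator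
`[V, W] = ∑_s ((∂_x^s V) ∂W/∂u^{(s)} - (∂_x^s W) ∂V/∂u^{(s)})`. -/
def vectorBracket (V W : DiffRat) : DiffRat := along V W - along W V

/-! ## Bivectors -/

/-- A local bivector `∑_s A_s δ^{(s)}(x - y)`, written as the differential operator
`∑_s A_s ∂_x^s`. -/
abbrev Bivector : Type := Module.End ℝ DiffRat

/-- `δ'(x - y)`. -/
def deltaPrime : Bivector := totalD

/-- `g δ'(x - y) + ½ g_x δ(x - y)`. -/
def hydro (g : DiffRat) : Bivector :=
  LinearMap.mulLeft ℝ g ∘ₗ (totalD : DiffRat →ₗ[ℝ] DiffRat) +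
    (1 / 2 : ℝ) • LinearMap.mulLeft ℝ (totalD g)

/-- The derivative of the coefficients of the operator `P` along the vector field `v`, applied
to `f`. As `along v` commutes with `∂_x`, this is the commutator of `along v` and `P`. -/
def coeffAlong (v : DiffRat) (P : Bivector) (f : DiffRat) : DiffRat :=
  along v (P f) - P (along v f)

/-- The trivector `[P, Q]` contracted with three covectors, as the density of a local functional:
the sum over the cyclic permutations of `α, β, γ` of
`∫ α (P'[Qγ] β + Q'[Pγ] β) dx`, where `P'[v]` has the coefficients of `P` differentiated
along `v`. -/
def schouten (P Q : Bivector) (α β γ : DiffRat) : DiffRat :=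
  α * (coeffAlong (Q γ) P β + coeffAlong (P γ) Q β) +
    β * (coeffAlong (Q α) P γ + coeffAlong (P α) Q γ) +
      γ * (coeffAlong (Q β) P α + coeffAlong (P β) Q α)

/-- `[P, Q] = o(ε^k)` for `P = ∑ ε^n P_n` and `Q = ∑ ε^n Q_n`: up to order `k` the trivector
vanishes on all covectors, modulo total derivatives. -/
def SchoutenVanishes (k : ℕ) (P Q : ℕ → Bivector) : Prop :=
  ∀ n ≤ k, ∀ α β γ : DiffPoly,
    ∃ h : DiffRat, (∑ p ∈ Finset.HasAntidiagonal.antidiagonal n, schouten (P p.1) (Q p.2)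
      (algebraMap DiffPoly DiffRat α) (algebraMap DiffPoly DiffRat β)
      (algebraMap DiffPoly DiffRat γ)) = totalD h

/-- `(P₁, P₂)` is bihamiltonian up to order `k` in `ε`. -/
def IsDeformation (k : ℕ) (P₁ P₂ : ℕ → Bivector) : Prop :=
  SchoutenVanishes k P₁ P₁ ∧ SchoutenVanishes k P₂ P₂ ∧ SchoutenVanishes k P₁ P₂

/-- The Lie derivative of a bivector along the vector field `X`; it is also the differential
`d_P X = [P, X]`. -/
def lieDer (X : DiffRat) (P : Bivector) : Bivector :=
  (along X : DiffRat →ₗ[ℝ] DiffRat) ∘ₗ P - P ∘ₗ (along X : DiffRat →ₗ[ℝ] DiffRat) -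
    frechet X ∘ₗ P - P ∘ₗ frechetAdj X

/-- The hamiltonian vector field `d_P I = P (δI/δu)` of the local functional `I = ∫ f dx`. -/
def hamField (P : Bivector) (f : DiffRat) : DiffRat := P (varDeriv f)

/-- The second order vector field `s(u) u_xx + s'(u) u_x²`. -/
def secondOrderField (s : SmoothFun) : DiffRat :=
  fn s * jet 2 + fn (derivFun s) * jet 1 ^ 2

/-- The density `b(u) u_xx / u_x`. -/
def densityB (b : SmoothFun) : DiffRat := fn b * jet 2 * uxInv

/-- The rational density
`-¾ b' b'' u_xx² / u_x + (7/5) (b')² u_xx³ / u_x³ - (3/2) (b')² u_xx u_xxx / u_x²`. -/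
def densityRho (b : SmoothFun) : DiffRat :=
  (-3 / 4 : ℝ) • (fn (derivFun b * derivFun (derivFun b)) * jet 2 ^ 2 * uxInv) +
    (7 / 5 : ℝ) • (fn (derivFun b ^ 2) * jet 2 ^ 3 * uxInv ^ 3) -
      (3 / 2 : ℝ) • (fn (derivFun b ^ 2) * jet 2 * jet 3 * uxInv ^ 2)

/-! ## The quasi-Miura group -/

/-- `u ↦ ū = ∑_k ε^k F_k` is a quasi-Miura transformation: `F_k` is a ratio of differential
polynomials of degree `k`, and `∂F_0/∂u` is not a zero divisor among the ratios. -/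
def IsQuasiMiura (F : ℕ → DiffRat) : Prop :=
  (∀ k, HasDegree (F k) k) ∧ IsUnit (partialD 0 (F 0))

/-- The coefficient of `ε^n` of the bivector `∑ ε^j P_j` after the change of coordinates
`ū = ∑ ε^i F_i`, namely of `ū_* ∘ P ∘ ū_*†` (written in terms of `u`). -/
def pushforward (F : ℕ → DiffRat) (P : ℕ → Bivector) (n : ℕ) : Bivector :=
  ∑ p ∈ Finset.HasAntidiagonal.antidiagonal n, ∑ q ∈ Finset.HasAntidiagonal.antidiagonal p.2,
    frechet (F p.1) ∘ₗ P q.1 ∘ₗ frechetAdj (F q.2)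

/-- The transformation `ū = ∑ ε^n F_n` brings `(P₁, P₂)` to the form
`P₁ = δ'(x - y) + O(ε^{k+1})`,
`P₂ = ū δ'(x - y) + ½ ū_x δ(x - y) + ε^k Q + O(ε^{k+1})`.
(The term `Q` may be written in terms of `u`, as `ū = u + O(ε)` in the cases with `Q ≠ 0`.) -/
def BringsTo (k : ℕ) (F : ℕ → DiffRat) (P₁ P₂ : ℕ → Bivector) (Q : Bivector) : Prop :=
  ∀ n ≤ k, pushforward F P₁ n = (if n = 0 then deltaPrime else 0) ∧
    pushforward F P₂ n = hydro (F n) + (if n = k then Q else 0)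

/-- The deformation `(P₁, P₂)` of order `k` of `(δ', u δ' + ½ u_x δ)` is quasi-trivial: it is
eliminated by a quasi-Miura transformation. -/
def IsQuasiTrivial (k : ℕ) (P₁ P₂ : ℕ → Bivector) : Prop :=
  ∃ F : ℕ → DiffRat, IsQuasiMiura F ∧ BringsTo k F P₁ P₂ 0

/-- The transformation `ū = exp(ε^m X) u` generated by the vector field `ε^m X` (`m ≥ 1`):
the coefficient of `ε^{jm}` is `X^j(u) / j!`. -/
def expFlow (m : ℕ) (X : DiffRat) (n : ℕ) : DiffRat :=
  if m ∣ n then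
    (((n / m).factorial : ℝ)⁻¹) • ((along X : DiffRat →ₗ[ℝ] DiffRat) ^ (n / m)) (jet 0)
  else 0

end LoopSpace

end

open LoopSpace

namespace LoopSpace

/-! ## Derivations of ratios of differential polynomials -/

/-! The argument has three layers. On the formal side, Fréchet derivatives, their adjoints and
variational derivatives form a calculus in which the Lie derivative represents the commutator of
vector fields (`lieDer_vectorBracket`), variational derivatives are closed covectors
(`isClosedCovector_varDeriv`), and consequently d₁ kills d₁ of any functional and d₁d₂ = -d₂d₁ on
functionals (`lieDer_totalD_deltaPrime`, `lieDer_totalD_hydro`).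

The equation [P₂, P₂] = 0 at order four, 2[P₂⁽⁰⁾, P₂⁽⁴⁾] + [P₂⁽²⁾, P₂⁽²⁾] = 0, is a trivector
identity, but it need only be tested on a few closed covectors. Contracting with two closed
covectors gives a vector field (`functional_schouten`), which vanishes because the pairing is
nondegenerate (`eq_zero_of_functional_mul`). The pair (1, u) yields an equation for δX⁽⁴⁾/δu along
the Hopf flow, which makes X⁽⁴⁾ a total derivative. The pair (u, u²) then fixes the coefficient of
u_xxxx to be -2ss'. This leaves X⁽⁴⁾ with two free functions of u
(`constraints_of_schoutenVanishes`).

Conversely, the density ρ is built so that in d₁(-∫uρ) + d₂∫ρ - ½[d₁B, d₂B] all powers of 1/u_x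
cancel (`hamField_eliminant`). Adding a u_x³ and c u_x³ to the densities supplies exactly the two
missing functions, so every admissible X⁽⁴⁾ has the claimed form
(`exists_eq_hamField_add_hamField`). Anticommutation of d₁ and d₂ turns this into Lie_Y P₂⁽⁰⁾ =
P₂⁽⁴⁾ - ½Lie_X² P₂⁽⁰⁾ (`lieDer_deltaPrime_of_eq_hamField`).

Finally, the action of ū = u + ε²X + ε⁴(½X(X) + Y) on bivectors is expanded to order four
(`pushforward_four`). Commutators with the derivations along X and Y account for writing
coefficients in u instead of ū, and what remains is the exponential of Lie derivatives. The same
expansion serves the combined transformation and both single flows (`bringsTo_of_lieDer_eq`). -/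

@[simp] lemma partialD_fn_zero (f : SmoothFun) : partialD 0 (fn f) = fn (derivFun f) := by
  rw [fn, partialD_algebraMap]
  congr 1
  exact coeffDerivLin_monomial 0 f

@[simp] lemma partialD_fn_succ (n : ℕ) (f : SmoothFun) : partialD (n + 1) (fn f) = 0 := by
  rw [fn, partialD_algebraMap]
  simp [partialPoly]

lemma derivFun_id : derivFun ⟨fun x => x, show ContDiff ℝ ∞ fun x : ℝ => x from contDiff_id⟩ = 1 := by
  ext x
  exact deriv_id x

@[simp] lemma fn_one : fn 1 = 1 := by simp [fn]

@[simp] lemma fn_zero : fn 0 = 0 := by simp [fn]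

lemma fn_add (f g : SmoothFun) : fn (f + g) = fn f + fn g := by simp [fn]

lemma fn_mul (f g : SmoothFun) : fn (f * g) = fn f * fn g := by simp [fn]

lemma fn_pow (f : SmoothFun) (n : ℕ) : fn (f ^ n) = fn f ^ n := by simp [fn]

lemma fn_smul (r : ℝ) (f : SmoothFun) : fn (r • f) = r • fn f := by
  have : (MvPolynomial.C (r • f) : DiffPoly) = r • MvPolynomial.C f := by
    simp only [MvPolynomial.C_apply, MvPolynomial.smul_monomial]
  rw [fn, this, Algebra.algebraMap_eq_smul_one, smul_assoc, ← Algebra.algebraMap_eq_smul_one, fn]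

lemma partialD_jet (s t : ℕ) : partialD s (jet t) = if s = t then 1 else 0 := by
  cases t with
  | zero =>
    cases s with
    | zero => simp [jet, derivFun_id]
    | succ s => simp [jet]
  | succ t =>
    rw [jet, partialD_algebraMap]
    cases s with
    | zero =>
      have : coeffDeriv (MvPolynomial.X t : DiffPoly) = 0 := by
        refine (coeffDerivLin_monomial _ 1).trans ?_
        simp
      simp [partialPoly, this]
    | succ s =>
      simp only [partialPoly, Derivation.restrictScalars_apply, MvPolynomial.pderiv_X,
        Pi.single_apply, Nat.add_right_cancel_iff, eq_comm (a := t)]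
      split_ifs <;> simp

/-- A derivation of ratios of differential polynomials is determined by its values on smooth
functions of `u` and on the jet variables. -/
lemma derivation_ext {d₁ d₂ : Derivation ℝ DiffRat DiffRat} (hf : ∀ f, d₁ (fn f) = d₂ (fn f))
    (hj : ∀ n, d₁ (jet (n + 1)) = d₂ (jet (n + 1))) : d₁ = d₂ := by
  have hp : ∀ p : DiffPoly, d₁ (algebraMap DiffPoly DiffRat p) = d₂ (algebraMap DiffPoly DiffRat p) := by
    intro p
    induction p using MvPolynomial.induction_on with
    | C a => exact hf a
    | add p q hp hq => simp only [map_add, hp, hq]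
    | mul_X p n hp =>
      have := hj n
      simp only [jet] at this
      simp only [map_mul, Derivation.leibniz, hp, this]
  ext q
  obtain ⟨a, g, rfl⟩ := IsLocalization.exists_mk'_eq DiffPoly⁰ q
  have hu : IsUnit (algebraMap DiffPoly DiffRat g) := IsLocalization.map_units DiffRat g
  have h := IsLocalization.mk'_spec DiffRat a g
  have h1 := congrArg d₁ h
  have h2 := congrArg d₂ h
  rw [Derivation.leibniz] at h1 h2
  rw [hp, hp, ← h2] at h1
  simp only [smul_eq_mul] at h1
  exact hu.mul_left_cancel (add_left_cancel h1)

lemma vecField_apply (c : ℕ → DiffRat) (f : DiffRat) :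
    vecField c f = ∑ᶠ s, c s * partialD s f := rfl

@[simp] lemma vecField_fn (c : ℕ → DiffRat) (f : SmoothFun) :
    vecField c (fn f) = c 0 * fn (derivFun f) := by
  rw [vecField_apply, finsum_eq_single _ 0, partialD_fn_zero]
  intro s hs
  obtain ⟨n, rfl⟩ := Nat.exists_eq_succ_of_ne_zero hs
  simp

@[simp] lemma vecField_jet (c : ℕ → DiffRat) (n : ℕ) : vecField c (jet n) = c n := by
  rw [vecField_apply, finsum_eq_single _ n]
  · simp [partialD_jet]
  · intro s hs
    simp [partialD_jet, hs]

/-- Coordinate derivations commute. -/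
lemma partialD_comm (s t : ℕ) (f : DiffRat) : partialD s (partialD t f) = partialD t (partialD s f) := by
  have h : ⁅partialD s, partialD t⁆ = 0 := by
    refine derivation_ext (fun f => ?_) (fun n => ?_)
    · cases s <;> cases t <;> simp [Derivation.commutator_apply]
    · simp only [Derivation.commutator_apply, partialD_jet]
      split_ifs <;> simp
  have := congrArg (fun d => d f) h
  simpa [Derivation.commutator_apply, sub_eq_zero] using this

/-- The commutator of a coordinate derivation and a vector field. -/
lemma partialD_vecField (s : ℕ) (c : ℕ → DiffRat) (f : DiffRat) :
    partialD s (vecField c f) = vecField c (partialD s f) + vecField (fun t => partialD s (c t)) f := by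
  have h : ⁅partialD s, vecField c⁆ = vecField (fun t => partialD s (c t)) := by
    refine derivation_ext (fun f => ?_) (fun n => ?_)
    · cases s <;> simp [Derivation.commutator_apply, Derivation.leibniz, mul_comm]
    · simp only [Derivation.commutator_apply, vecField_jet, partialD_jet]
      split_ifs <;> simp
  rw [← h, Derivation.commutator_apply]
  ring

@[simp] lemma totalD_fn (f : SmoothFun) : totalD (fn f) = jet 1 * fn (derivFun f) := vecField_fn _ f

@[simp] lemma totalD_jet (n : ℕ) : totalD (jet n) = jet (n + 1) := vecField_jet _ n

@[simp] lemma dPow_zero (f : DiffRat) : dPow 0 f = f := by simp [dPow]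

lemma dPow_succ (n : ℕ) (f : DiffRat) : dPow (n + 1) f = totalD (dPow n f) := by
  simp [dPow, pow_succ']

@[simp] lemma dPow_jet (n k : ℕ) : dPow n (jet k) = jet (k + n) := by
  induction n with
  | zero => simp
  | succ n ih => rw [dPow_succ, ih, totalD_jet, add_assoc]

lemma dPow_succ' (n : ℕ) (f : DiffRat) : dPow (n + 1) f = dPow n (totalD f) := by
  simp [dPow, pow_succ]

@[simp] lemma along_fn (v : DiffRat) (f : SmoothFun) : along v (fn f) = v * fn (derivFun f) := by
  simp [along]

lemma along_jet (v : DiffRat) (n : ℕ) : along v (jet n) = dPow n v := vecField_jet _ n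

@[simp] lemma along_jet_zero (v : DiffRat) : along v (jet 0) = v := by simp [along_jet]

/-- Translation invariant vector fields commute with the total derivative. -/
lemma along_totalD (v f : DiffRat) : along v (totalD f) = totalD (along v f) := by
  have h : ⁅along v, totalD⁆ = 0 := by
    refine derivation_ext (fun f => ?_) (fun n => ?_)
    · simp only [Derivation.commutator_apply, totalD_fn, along_fn, Derivation.leibniz, along_jet,
        smul_eq_mul, Derivation.zero_apply, dPow_succ, dPow_zero]
      ring
    · simp [Derivation.commutator_apply, along_jet, dPow_succ]
  have := congrArg (fun d => d f) h
  simpa [Derivation.commutator_apply, sub_eq_zero] using this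

lemma along_dPow (v f : DiffRat) (n : ℕ) : along v (dPow n f) = dPow n (along v f) := by
  induction n with
  | zero => simp
  | succ n ih => rw [dPow_succ, along_totalD, ih, dPow_succ]

/-- The commutator of two translation invariant vector fields. -/
lemma along_along (V W f : DiffRat) :
    along V (along W f) - along W (along V f) = along (vectorBracket V W) f := by
  have h : ⁅along V, along W⁆ = along (vectorBracket V W) := by
    refine derivation_ext (fun f => ?_) (fun n => ?_)
    · simp only [Derivation.commutator_apply, along_fn, Derivation.leibniz, smul_eq_mul,
        vectorBracket]
      ring
    · simp [Derivation.commutator_apply, along_jet, along_dPow, vectorBracket]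
  rw [← h, Derivation.commutator_apply]

lemma frechet_apply (v f : DiffRat) : frechet v f = along f v :=
  finsum_congr fun _ => mul_comm _ _

lemma along_add (v w f : DiffRat) : along (v + w) f = along v f + along w f := by
  simp only [← frechet_apply, map_add]

lemma along_sub (v w f : DiffRat) : along (v - w) f = along v f - along w f := by
  simp only [← frechet_apply, map_sub]

lemma along_smul (r : ℝ) (v f : DiffRat) : along (r • v) f = r • along v f := by
  simp only [← frechet_apply, map_smul]

lemma along_neg (v f : DiffRat) : along (-v) f = -along v f := by
  simp only [← frechet_apply, map_neg]

@[simp] lemma along_zero (f : DiffRat) : along 0 f = 0 := by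
  simp only [← frechet_apply, map_zero]

/-- Translation in `x` is the flow of the total derivative. -/
lemma along_jet_one (f : DiffRat) : along (jet 1) f = totalD f := by
  have h : along (jet 1) = totalD := by
    refine derivation_ext (fun f => by simp) (fun n => ?_)
    rw [along_jet, totalD_jet, dPow_jet, add_comm, add_comm n, add_assoc]
  rw [h]

/-! ## Adjoint Fréchet derivatives -/

lemma exists_partialD_eq_zero (v : DiffRat) : ∃ N, ∀ s, N ≤ s → partialD s v = 0 := by
  obtain ⟨N, hN⟩ := (finite_partialD v).bddAbove
  refine ⟨N + 1, fun s hs => ?_⟩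
  by_contra h
  exact absurd (hN h) (by omega)

lemma vecField_eq_sum {v : DiffRat} {N : ℕ} (hN : ∀ s, N ≤ s → partialD s v = 0) (c : ℕ → DiffRat) :
    vecField c v = ∑ s ∈ Finset.range N, c s * partialD s v := by
  rw [vecField_apply]
  refine finsum_eq_sum_of_support_subset _ fun s hs => ?_
  by_contra h
  simp only [Finset.coe_range, Set.mem_Iio, not_lt] at h
  exact hs (by simp [hN s h])

lemma frechetAdj_eq_sum {v : DiffRat} {N : ℕ} (hN : ∀ s, N ≤ s → partialD s v = 0) (f : DiffRat) :
    frechetAdj v f = ∑ s ∈ Finset.range N, (-1 : ℝ) ^ s • dPow s (partialD s v * f) := by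
  refine finsum_eq_sum_of_support_subset _ fun s hs => ?_
  by_contra h
  simp only [Finset.coe_range, Set.mem_Iio, not_lt] at h
  exact hs (by simp [hN s h])

lemma varDeriv_eq_frechetAdj (f : DiffRat) : varDeriv f = frechetAdj f 1 :=
  finsum_congr fun s => by rw [mul_one]

lemma frechetAdj_add (v w f : DiffRat) :
    frechetAdj (v + w) f = frechetAdj v f + frechetAdj w f := by
  obtain ⟨M, hM⟩ := exists_partialD_eq_zero v
  obtain ⟨N, hN⟩ := exists_partialD_eq_zero w
  have h1 : ∀ s, max M N ≤ s → partialD s v = 0 := fun s hs => hM s (le_of_max_le_left hs)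
  have h2 : ∀ s, max M N ≤ s → partialD s w = 0 := fun s hs => hN s (le_of_max_le_right hs)
  have h3 : ∀ s, max M N ≤ s → partialD s (v + w) = 0 := fun s hs => by simp [h1 s hs, h2 s hs]
  rw [frechetAdj_eq_sum h1, frechetAdj_eq_sum h2, frechetAdj_eq_sum h3, ← Finset.sum_add_distrib]
  simp only [map_add, add_mul, smul_add]

lemma frechetAdj_smul (r : ℝ) (v f : DiffRat) : frechetAdj (r • v) f = r • frechetAdj v f := by
  obtain ⟨M, hM⟩ := exists_partialD_eq_zero v
  have h3 : ∀ s, M ≤ s → partialD s (r • v) = 0 := fun s hs => by simp [hM s hs]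
  rw [frechetAdj_eq_sum hM, frechetAdj_eq_sum h3, Finset.smul_sum]
  simp only [Derivation.map_smul, smul_mul_assoc, map_smul, smul_comm r]

lemma frechetAdj_neg (v f : DiffRat) : frechetAdj (-v) f = -frechetAdj v f := by
  rw [← neg_one_smul ℝ v, frechetAdj_smul, neg_one_smul]

lemma frechetAdj_sub (v w f : DiffRat) :
    frechetAdj (v - w) f = frechetAdj v f - frechetAdj w f := by
  rw [sub_eq_add_neg, frechetAdj_add, frechetAdj_neg, ← sub_eq_add_neg]

@[simp] lemma frechetAdj_zero (f : DiffRat) : frechetAdj 0 f = 0 := by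
  simpa using frechetAdj_smul 0 0 f

/-- The adjoint Fréchet derivative of a product. -/
lemma frechetAdj_mul (g h f : DiffRat) :
    frechetAdj (g * h) f = frechetAdj g (h * f) + frechetAdj h (g * f) := by
  obtain ⟨M, hM⟩ := exists_partialD_eq_zero g
  obtain ⟨N, hN⟩ := exists_partialD_eq_zero h
  have h1 : ∀ s, max M N ≤ s → partialD s g = 0 := fun s hs => hM s (le_of_max_le_left hs)
  have h2 : ∀ s, max M N ≤ s → partialD s h = 0 := fun s hs => hN s (le_of_max_le_right hs)
  have h3 : ∀ s, max M N ≤ s → partialD s (g * h) = 0 := fun s hs => by simp [h1 s hs, h2 s hs]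
  rw [frechetAdj_eq_sum h1, frechetAdj_eq_sum h2, frechetAdj_eq_sum h3, ← Finset.sum_add_distrib]
  refine Finset.sum_congr rfl fun s _ => ?_
  rw [← smul_add, ← map_add, Derivation.leibniz]
  congr 2
  simp only [smul_eq_mul]
  ring

/-- The partial derivatives of a total derivative. -/
lemma partialD_totalD_zero (f : DiffRat) : partialD 0 (totalD f) = totalD (partialD 0 f) := by
  rw [totalD, partialD_vecField]
  simp [partialD_jet, vecField_apply]

lemma partialD_totalD_succ (s : ℕ) (f : DiffRat) :
    partialD (s + 1) (totalD f) = totalD (partialD (s + 1) f) + partialD s f := by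
  rw [totalD, partialD_vecField]
  congr 1
  rw [vecField_apply, finsum_eq_single _ s]
  · simp [partialD_jet]
  · intro t ht
    simp [partialD_jet, ht.symm]

/-- The Fréchet derivative of ∂v is ∂ ∘ v_*, and ∂ is skew-adjoint; on coefficients this is the
relation [∂/∂u^{(s+1)}, ∂_x] = ∂/∂u^{(s)}. -/
lemma frechetAdj_totalD (v f : DiffRat) : frechetAdj (totalD v) f = -frechetAdj v (totalD f) := by
  obtain ⟨N, hN⟩ := exists_partialD_eq_zero v
  have h : ∀ s, N + 1 ≤ s → partialD s (totalD v) = 0 := by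
    rintro (_ | s) hs
    · omega
    · rw [partialD_totalD_succ, hN s (by omega), hN (s + 1) (by omega)]
      simp
  rw [frechetAdj_eq_sum h, frechetAdj_eq_sum hN, Finset.sum_range_succ']
  simp only [partialD_totalD_succ, partialD_totalD_zero, add_mul, map_add, smul_add,
    Finset.sum_add_distrib]
  have h1 : ∀ s, dPow (s + 1) (partialD s v * f) =
      dPow s (totalD (partialD s v) * f) + dPow s (partialD s v * totalD f) := fun s => by
    rw [dPow_succ', ← map_add]
    congr 1
    rw [Derivation.leibniz, smul_eq_mul, smul_eq_mul]
    ring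
  simp only [h1, smul_add, Finset.sum_add_distrib]
  -- Shift of the summation index: both ranges may stop at N because the derivative of `v` of index
  -- N vanishes.
  have h2 : (∑ s ∈ Finset.range N, (-1 : ℝ) ^ (s + 1) • dPow (s + 1) (totalD (partialD (s + 1) v) * f))
      + (-1 : ℝ) ^ 0 • dPow 0 (totalD (partialD 0 v) * f) =
      ∑ s ∈ Finset.range N, (-1 : ℝ) ^ s • dPow s (totalD (partialD s v) * f) := by
    rw [← Finset.sum_range_succ' fun s => (-1 : ℝ) ^ s • dPow s (totalD (partialD s v) * f),
      Finset.sum_range_succ, hN N le_rfl]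
    simp
  simp only [pow_succ, mul_neg_one, neg_smul, Finset.sum_neg_distrib] at h2 ⊢
  rw [← h2]
  abel

lemma frechetAdj_dPow (v f : DiffRat) (n : ℕ) :
    frechetAdj (dPow n v) f = (-1 : ℝ) ^ n • frechetAdj v (dPow n f) := by
  induction n generalizing f with
  | zero => simp
  | succ n ih =>
    rw [dPow_succ, frechetAdj_totalD, ih, dPow_succ', pow_succ, mul_neg_one, neg_smul]

@[simp] lemma varDeriv_totalD (f : DiffRat) : varDeriv (totalD f) = 0 := by
  rw [varDeriv_eq_frechetAdj, frechetAdj_totalD, Derivation.map_one_eq_zero, map_zero, neg_zero]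

lemma frechetAdj_sum {ι : Type*} (S : Finset ι) (v : ι → DiffRat) (f : DiffRat) :
    frechetAdj (∑ i ∈ S, v i) f = ∑ i ∈ S, frechetAdj (v i) f := by
  classical
  induction S using Finset.induction_on with
  | empty => simp
  | insert a S ha ih => rw [Finset.sum_insert ha, Finset.sum_insert ha, frechetAdj_add, ih]

/-- The adjoint Fréchet derivative of the derivative of `W` along `V`. -/
lemma frechetAdj_along (V W f : DiffRat) : frechetAdj (along V W) f =
    along V (frechetAdj W f) - frechetAdj W (along V f) + frechetAdj V (frechetAdj W f) := by
  obtain ⟨N, hN⟩ := exists_partialD_eq_zero W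
  have h1 : along V W = ∑ t ∈ Finset.range N, dPow t V * partialD t W := vecField_eq_sum hN _
  have h2 : ∀ t, frechetAdj (dPow t V) (partialD t W * f) =
      frechetAdj V ((-1 : ℝ) ^ t • dPow t (partialD t W * f)) := fun t => by
    rw [frechetAdj_dPow, map_smul]
  -- The second derivatives of W form a symmetric matrix, so the sum in which W is differentiated by
  -- u^{(t)} and varied by u^{(s)} is the derivative along V of the coefficients of the adjoint.
  have h3 : ∑ t ∈ Finset.range N, frechetAdj (partialD t W) (dPow t V * f) =
      along V (frechetAdj W f) - frechetAdj W (along V f) := by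
    have h4 : ∀ t, ∀ s, N ≤ s → partialD s (partialD t W) = 0 := fun t s hs => by
      rw [partialD_comm, hN s hs, map_zero]
    simp only [frechetAdj_eq_sum hN, frechetAdj_eq_sum (h4 _), map_sum, Derivation.map_smul,
      along_dPow, Derivation.leibniz, smul_eq_mul, map_add, smul_add, Finset.sum_add_distrib]
    rw [add_sub_cancel_left, Finset.sum_comm]
    refine Finset.sum_congr rfl fun s _ => ?_
    rw [along, vecField_eq_sum (h4 s), Finset.mul_sum, map_sum, Finset.smul_sum]
    refine Finset.sum_congr rfl fun t _ => ?_
    rw [partialD_comm]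
    congr 2
    ring
  rw [h1, frechetAdj_sum]
  simp only [frechetAdj_mul, h2, h3, Finset.sum_add_distrib]
  rw [← map_sum, ← frechetAdj_eq_sum hN, add_comm]

/-! ## Local functionals -/

/-- The local functional `∫ f dx`: the class of the density `f` modulo total derivatives. -/
noncomputable def functional : DiffRat →ₗ[ℝ] DiffRat ⧸ (totalD : DiffRat →ₗ[ℝ] DiffRat).range :=
  (totalD : DiffRat →ₗ[ℝ] DiffRat).range.mkQ

@[simp] lemma functional_totalD (f : DiffRat) : functional (totalD f) = 0 :=
  (Submodule.Quotient.mk_eq_zero _).2 ⟨f, rfl⟩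

lemma functional_eq_zero_iff {f : DiffRat} : functional f = 0 ↔ ∃ h, f = totalD h :=
  (Submodule.Quotient.mk_eq_zero _).trans ⟨fun ⟨h, hh⟩ => ⟨h, hh.symm⟩, fun ⟨h, hh⟩ => ⟨h, hh.symm⟩⟩

lemma varDeriv_add (f g : DiffRat) : varDeriv (f + g) = varDeriv f + varDeriv g := by
  simp only [varDeriv_eq_frechetAdj, frechetAdj_add]

lemma varDeriv_sub (f g : DiffRat) : varDeriv (f - g) = varDeriv f - varDeriv g := by
  simp only [varDeriv_eq_frechetAdj, frechetAdj_sub]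

lemma varDeriv_smul (r : ℝ) (f : DiffRat) : varDeriv (r • f) = r • varDeriv f := by
  simp only [varDeriv_eq_frechetAdj, frechetAdj_smul]

lemma varDeriv_neg (f : DiffRat) : varDeriv (-f) = -varDeriv f := by
  simp only [varDeriv_eq_frechetAdj, frechetAdj_neg]

/-- The variational derivative depends only on the local functional. -/
lemma varDeriv_congr {f g : DiffRat} (h : functional f = functional g) : varDeriv f = varDeriv g := by
  rw [← sub_eq_zero, ← map_sub, functional_eq_zero_iff] at h
  obtain ⟨k, hk⟩ := h
  rw [← sub_eq_zero, ← varDeriv_sub, hk, varDeriv_totalD]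

/-- Integration by parts. -/
lemma functional_mul_totalD (f g : DiffRat) :
    functional (f * totalD g) = -functional (totalD f * g) := by
  have h := functional_totalD (f * g)
  rw [Derivation.leibniz, smul_eq_mul, smul_eq_mul, map_add, mul_comm g] at h
  exact eq_neg_of_add_eq_zero_left h

lemma functional_mul_dPow (n : ℕ) (f g : DiffRat) :
    functional (f * dPow n g) = functional (((-1 : ℝ) ^ n • dPow n f) * g) := by
  induction n generalizing f with
  | zero => simp
  | succ n ih =>
    rw [dPow_succ, functional_mul_totalD, ih, dPow_succ', pow_succ, mul_neg_one, neg_smul, neg_mul,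
      map_neg]

/-- `f ↦ frechetAdj v f` is the adjoint of the Fréchet derivative of `v`. -/
lemma functional_mul_along (f g v : DiffRat) :
    functional (f * along g v) = functional (g * frechetAdj v f) := by
  obtain ⟨N, hN⟩ := exists_partialD_eq_zero v
  rw [along, vecField_eq_sum hN, frechetAdj_eq_sum hN, Finset.mul_sum, Finset.mul_sum, map_sum,
    map_sum]
  refine Finset.sum_congr rfl fun s _ => ?_
  rw [mul_comm (dPow s g), ← mul_assoc, functional_mul_dPow, mul_comm g, mul_comm f]

lemma functional_along (g f : DiffRat) : functional (along g f) = functional (g * varDeriv f) := by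
  rw [varDeriv_eq_frechetAdj, ← functional_mul_along, one_mul]

lemma varDeriv_mul (g h : DiffRat) : varDeriv (g * h) = frechetAdj g h + frechetAdj h g := by
  rw [varDeriv_eq_frechetAdj, frechetAdj_mul, mul_one, mul_one]

/-- Covectors with symmetric Fréchet derivative, i.e. closed ones. -/
def IsClosedCovector (q : DiffRat) : Prop := ∀ f, frechetAdj q f = along f q

/-- The Helmholtz condition: variational derivatives are closed covectors. -/
lemma isClosedCovector_varDeriv (f : DiffRat) : IsClosedCovector (varDeriv f) := fun g => by
  -- The functionals ∫ along g f and ∫ g δf agree. Varying both, including the dependence of `g` on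
  -- u, produces one common term; the other terms are the two sides of the symmetry.
  have h := varDeriv_congr (functional_along g f)
  rw [varDeriv_mul, varDeriv_eq_frechetAdj (along g f), frechetAdj_along, Derivation.map_one_eq_zero,
    map_zero, sub_zero, ← varDeriv_eq_frechetAdj, add_comm] at h
  exact (add_left_cancel h).symm

lemma isClosedCovector_fn (f : SmoothFun) : IsClosedCovector (fn f) := fun g => by
  rw [frechetAdj_eq_sum (N := 1), Finset.sum_range_one, along_fn]
  · simp [mul_comm]
  · rintro (_ | s) hs
    · omega
    · simp

/-! ## Lie derivatives -/

lemma hydro_apply (g f : DiffRat) : hydro g f = g * totalD f + (1 / 2 : ℝ) • (totalD g * f) := rfl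

lemma deltaPrime_apply (f : DiffRat) : deltaPrime f = totalD f := rfl

lemma hydro_zero : hydro 0 = 0 := by
  ext f
  simp [hydro_apply]

lemma hydro_add (g h : DiffRat) : hydro (g + h) = hydro g + hydro h := by
  ext f
  simp only [hydro_apply, map_add, add_mul, smul_add, LinearMap.add_apply]
  abel

lemma hydro_smul (r : ℝ) (g : DiffRat) : hydro (r • g) = r • hydro g := by
  ext f
  simp only [hydro_apply, LinearMap.smul_apply, Derivation.map_smul, smul_mul_assoc, smul_add,
    smul_comm r]

lemma lieDer_apply (X : DiffRat) (P : Bivector) (f : DiffRat) : lieDer X P f =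
    along X (P f) - P (along X f) - along (P f) X - P (frechetAdj X f) := by
  simp [lieDer, frechet_apply]

lemma lieDer_add (X Y : DiffRat) (P : Bivector) : lieDer (X + Y) P = lieDer X P + lieDer Y P := by
  ext f
  simp only [lieDer_apply, along_add, map_add, frechetAdj_add, LinearMap.add_apply]
  abel

lemma lieDer_smul (r : ℝ) (X : DiffRat) (P : Bivector) : lieDer (r • X) P = r • lieDer X P := by
  ext f
  simp only [lieDer_apply, along_smul, map_smul, Derivation.map_smul, frechetAdj_smul,
    LinearMap.smul_apply, smul_sub]

lemma lieDer_neg (X : DiffRat) (P : Bivector) : lieDer (-X) P = -lieDer X P := by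
  ext f
  simp only [lieDer_apply, along_neg, map_neg, frechetAdj_neg, LinearMap.neg_apply]
  abel

lemma lieDer_sub (X Y : DiffRat) (P : Bivector) : lieDer (X - Y) P = lieDer X P - lieDer Y P := by
  rw [sub_eq_add_neg, lieDer_add, lieDer_neg, ← sub_eq_add_neg]

/-- The Lie derivative is a representation of the Lie algebra of vector fields. -/
lemma lieDer_vectorBracket (V W : DiffRat) (P : Bivector) :
    lieDer (vectorBracket V W) P = lieDer V (lieDer W P) - lieDer W (lieDer V P) := by
  ext f
  have h1 : ∀ g, along (vectorBracket V W) g = along V (along W g) - along W (along V g) :=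
    fun g => (along_along V W g).symm
  have h2 : ∀ g, along g (vectorBracket V W) =
      along V (along g W) - along (along V g) W + along (along g V) W -
        (along W (along g V) - along (along W g) V + along (along g W) V) := fun g => by
    have h3 := along_along g V W
    have h4 := along_along g W V
    simp only [vectorBracket, along_sub] at h3 h4
    rw [vectorBracket, map_sub, eq_add_of_sub_eq h3, eq_add_of_sub_eq h4]
    abel
  have h5 : ∀ g, frechetAdj (vectorBracket V W) g = along V (frechetAdj W g) -
      frechetAdj W (along V g) + frechetAdj V (frechetAdj W g) - (along W (frechetAdj V g) -
      frechetAdj V (along W g) + frechetAdj W (frechetAdj V g)) := fun g => by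
    rw [vectorBracket, frechetAdj_sub, frechetAdj_along, frechetAdj_along]
  simp only [LinearMap.sub_apply, lieDer_apply, h1, h2, h5, map_add, map_sub, along_sub]
  abel

lemma lieDer_deltaPrime (X f : DiffRat) :
    lieDer X deltaPrime f = -(along (totalD f) X + totalD (frechetAdj X f)) := by
  rw [lieDer_apply]
  simp only [deltaPrime_apply, along_totalD]
  abel

lemma lieDer_hydro (X g f : DiffRat) : lieDer X (hydro g) f =
    hydro (along X g) f - along (hydro g f) X - hydro g (frechetAdj X f) := by
  rw [lieDer_apply]
  congr 2
  simp only [hydro_apply, map_add, Derivation.map_smul, Derivation.leibniz, smul_eq_mul,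
    along_totalD, smul_add]
  rw [mul_comm (totalD f), mul_comm f]
  abel

/-- Hamiltonian vector fields of `δ'` preserve it. -/
lemma lieDer_totalD_deltaPrime {q : DiffRat} (hq : IsClosedCovector q) :
    lieDer (totalD q) deltaPrime = 0 := by
  ext f
  rw [lieDer_deltaPrime, along_totalD, frechetAdj_totalD, hq, map_neg]
  simp

/-- The compatibility of `δ'` and `u δ' + ½ u_x δ`. -/
lemma lieDer_totalD_hydro {q : DiffRat} (hq : IsClosedCovector q) :
    lieDer (totalD q) (hydro (jet 0)) = -lieDer (hydro (jet 0) q) deltaPrime := by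
  ext f
  rw [LinearMap.neg_apply, lieDer_deltaPrime, lieDer_hydro, along_jet_zero]
  -- The operator u∂ + ½u_x is linear in u, so differentiating its coefficients along `g` gives
  -- `hydro g`.
  have h1 : ∀ g, along g (hydro (jet 0) q) = hydro g q + hydro (jet 0) (along g q) := fun g => by
    have h := lieDer_hydro g (jet 0) q
    rw [lieDer_apply, along_jet_zero] at h
    linear_combination h
  -- The adjoint of the Fréchet derivative of H(q), with H = u∂ + ½u_x: one part comes from varying
  -- the coefficients of H, the other is -q_*† ∘ H by skewness.
  have h2 : frechetAdj (hydro (jet 0) q) f = (totalD q * f) - (1 / 2 : ℝ) • totalD (q * f) -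
      frechetAdj q (hydro (jet 0) f) := by
    have h3 : ∀ g, frechetAdj (jet 0) g = g := fun g => by
      rw [jet, isClosedCovector_fn, ← jet, along_jet_zero]
    have h4 : frechetAdj q (totalD (jet 0 * f)) =
        frechetAdj q (jet 0 * totalD f) + frechetAdj q (totalD (jet 0) * f) := by
      rw [← map_add, Derivation.leibniz, smul_eq_mul, smul_eq_mul, mul_comm f]
    rw [hydro_apply, frechetAdj_add, frechetAdj_smul, frechetAdj_mul, frechetAdj_mul, h3,
      frechetAdj_totalD, frechetAdj_totalD, h3, hydro_apply, map_add, map_smul, h4]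
    module
  rw [h1, h2, frechetAdj_totalD, hq, hq]
  simp only [hydro_apply, Derivation.leibniz, smul_eq_mul, map_add, smul_add, map_neg, map_sub,
    Derivation.map_smul, along_totalD]
  algebra

/-! ## Transformations generated by vector fields -/

/-- The derivation along `v`, as an endomorphism. -/
noncomputable def alongEnd (v : DiffRat) : Module.End ℝ DiffRat := (along v : DiffRat →ₗ[ℝ] DiffRat)

lemma alongEnd_apply (v f : DiffRat) : alongEnd v f = along v f := rfl

/-- The cross term is the Fréchet derivative with coefficients differentiated along X, i.e. a
commutator. This is the second-order information needed to recognize a square of Lie derivatives. -/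
lemma frechet_along (X : DiffRat) : frechet (along X X) =
    alongEnd X * frechet X - frechet X * alongEnd X + frechet X * frechet X := by
  ext f
  simp only [LinearMap.add_apply, LinearMap.sub_apply, Module.End.mul_apply, alongEnd_apply,
    frechet_apply]
  have h := along_along f X X
  rw [vectorBracket, along_sub] at h
  linear_combination h

lemma frechetAdj_along_self (X : DiffRat) : frechetAdj (along X X) =
    alongEnd X * frechetAdj X - frechetAdj X * alongEnd X + frechetAdj X * frechetAdj X := by
  ext f
  exact frechetAdj_along X X f

lemma lieDer_eq (X : DiffRat) (P : Bivector) : lieDer X P =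
    alongEnd X * P - P * alongEnd X - frechet X * P - P * frechetAdj X := rfl

/-- Since `hydro g` is linear in `g`, commutators with the derivation along X account for the change
of hydro(u) into hydro(ū). -/
lemma alongEnd_mul_hydro (X g : DiffRat) :
    alongEnd X * hydro g - hydro g * alongEnd X = hydro (along X g) := by
  ext f
  simp only [LinearMap.sub_apply, Module.End.mul_apply, alongEnd_apply, hydro_apply, map_add,
    Derivation.map_smul, Derivation.leibniz, smul_eq_mul, along_totalD]
  algebra

lemma alongEnd_mul_deltaPrime (X : DiffRat) :
    alongEnd X * deltaPrime - deltaPrime * alongEnd X = 0 := by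
  ext f
  simp [alongEnd_apply, deltaPrime_apply, along_totalD]

lemma frechet_jet_zero : frechet (jet 0) = 1 := by
  ext f
  simp [frechet_apply]

lemma frechetAdj_jet_zero : frechetAdj (jet 0) = 1 := by
  ext f
  rw [jet, isClosedCovector_fn, ← jet, along_jet_zero, Module.End.one_apply]

lemma frechet_zero : frechet 0 = 0 := by
  ext f
  simp [frechet_apply]

lemma frechetAdj_zero_eq : frechetAdj 0 = 0 := by
  ext f
  simp

/-- The transformation `ū = u + ε² X + ε⁴ (½ X(X) + Y) + O(ε⁵)` acts on bivectors by the exponential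
of the Lie derivatives. -/
lemma pushforward_four (X Y : DiffRat) (F : ℕ → DiffRat) (h0 : F 0 = jet 0) (h1 : F 1 = 0)
    (h2 : F 2 = X) (h3 : F 3 = 0) (h4 : F 4 = (1 / 2 : ℝ) • along X X + Y) (P : ℕ → Bivector)
    (hP1 : P 1 = 0) (hP3 : P 3 = 0) :
    pushforward F P 0 = P 0 ∧ pushforward F P 1 = 0 ∧
    pushforward F P 2 = alongEnd X * P 0 - P 0 * alongEnd X - lieDer X (P 0) + P 2 ∧
    pushforward F P 3 = 0 ∧
    pushforward F P 4 = (1 / 2 : ℝ) • (alongEnd X * (alongEnd X * P 0 - P 0 * alongEnd X) -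
        (alongEnd X * P 0 - P 0 * alongEnd X) * alongEnd X) +
      (alongEnd X * (P 2 - lieDer X (P 0)) - (P 2 - lieDer X (P 0)) * alongEnd X) +
      (1 / 2 : ℝ) • lieDer X (lieDer X (P 0)) - lieDer X (P 2) + P 4 +
      (alongEnd Y * P 0 - P 0 * alongEnd Y - lieDer Y (P 0)) := by
  have hA : frechet ((1 / 2 : ℝ) • along X X + Y) = (1 / 2 : ℝ) •
      (alongEnd X * frechet X - frechet X * alongEnd X + frechet X * frechet X) + frechet Y := by
    rw [← frechet_along]
    ext f
    simp [frechet_apply]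
  have hB : frechetAdj ((1 / 2 : ℝ) • along X X + Y) = (1 / 2 : ℝ) •
      (alongEnd X * frechetAdj X - frechetAdj X * alongEnd X + frechetAdj X * frechetAdj X) +
        frechetAdj Y := by
    rw [← frechetAdj_along_self]
    ext f
    simp [frechetAdj_add, frechetAdj_smul]
  simp only [pushforward, Finset.Nat.antidiagonal_succ, Finset.Nat.antidiagonal_zero,
    Finset.map_singleton, Finset.sum_cons, Finset.sum_singleton, Finset.map_cons,
    Function.Embedding.prodMap, Function.Embedding.coeFn_mk, Prod.map, Function.Embedding.refl_apply,
    Nat.succ_eq_add_one, zero_add, ← Module.End.mul_eq_comp, h0, h1, h2, h3, h4, hP1, hP3,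
    frechet_zero, frechetAdj_zero_eq, frechet_jet_zero, frechetAdj_jet_zero, hA, hB, zero_mul,
    mul_zero, one_mul, mul_one, add_zero, Nat.reduceAdd, lieDer_eq]
  refine ⟨trivial, trivial, ?_, trivial, ?_⟩
  · abel
  · simp only [mul_add, add_mul, mul_sub, sub_mul, smul_add, smul_sub, mul_smul_comm,
      smul_mul_assoc, mul_assoc]
    module

/-! ## Degrees of ratios -/

/-- `q` is a ratio `F / G` of homogeneous differential polynomials with `deg F - deg G = k`, where
`k` may be negative. -/
def HasIntDegree (q : DiffRat) (k : ℤ) : Prop :=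
  ∃ (F G : DiffPoly) (n m : ℕ), G ∈ DiffPoly⁰ ∧ F.IsWeightedHomogeneous jetDegree n ∧
    G.IsWeightedHomogeneous jetDegree m ∧ (n : ℤ) - m = k ∧
    q * algebraMap DiffPoly DiffRat G = algebraMap DiffPoly DiffRat F

lemma HasIntDegree.hasDegree {q : DiffRat} {k : ℕ} (h : HasIntDegree q k) : HasDegree q k := by
  obtain ⟨F, G, n, m, hG, hF, hGm, hk, hq⟩ := h
  obtain rfl : n = m + k := by omega
  exact ⟨F, G, hG, m, hF, hGm, IsLocalization.eq_mk'_iff_mul_eq.2 hq⟩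

lemma hasIntDegree_algebraMap {F : DiffPoly} {n : ℕ} (hF : F.IsWeightedHomogeneous jetDegree n) :
    HasIntDegree (algebraMap DiffPoly DiffRat F) n :=
  ⟨F, 1, n, 0, one_mem _, hF, MvPolynomial.isWeightedHomogeneous_one _ _, by simp, by simp⟩

lemma hasIntDegree_zero (k : ℤ) : HasIntDegree 0 k := by
  have h1 : HasIntDegree 0 k := by
    rcases le_total 0 k with h | h
    · obtain ⟨n, rfl⟩ := Int.eq_ofNat_of_zero_le h
      simpa using hasIntDegree_algebraMap (MvPolynomial.isWeightedHomogeneous_zero _ jetDegree n)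
    -- A negative degree is realized by the denominator u_x^n.
    · obtain ⟨n, hn⟩ := Int.eq_ofNat_of_zero_le (neg_nonneg.2 h)
      have hX : (MvPolynomial.X 0 : DiffPoly).IsWeightedHomogeneous jetDegree 1 :=
        MvPolynomial.isWeightedHomogeneous_X _ _ 0
      refine ⟨0, MvPolynomial.X 0 ^ n, 0, n • 1, pow_mem (X_mem_nonZeroDivisors 0) n,
        MvPolynomial.isWeightedHomogeneous_zero _ _ _, hX.pow n, ?_, by simp⟩
      simp only [smul_eq_mul, mul_one]
      omega
  exact h1

lemma HasIntDegree.add {p q : DiffRat} {k : ℤ} (hp : HasIntDegree p k) (hq : HasIntDegree q k) :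
    HasIntDegree (p + q) k := by
  obtain ⟨F₁, G₁, n₁, m₁, hG₁, hF₁, hH₁, hk₁, h₁⟩ := hp
  obtain ⟨F₂, G₂, n₂, m₂, hG₂, hF₂, hH₂, hk₂, h₂⟩ := hq
  have hm : n₁ + m₂ = n₂ + m₁ := by omega
  refine ⟨F₁ * G₂ + F₂ * G₁, G₁ * G₂, n₁ + m₂, m₁ + m₂, mul_mem hG₁ hG₂,
    (hF₁.mul hH₂).add (hm ▸ hF₂.mul hH₁), hH₁.mul hH₂, by push_cast; omega, ?_⟩
  simp only [map_add, map_mul]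
  linear_combination algebraMap DiffPoly DiffRat G₂ * h₁ + algebraMap DiffPoly DiffRat G₁ * h₂

lemma HasIntDegree.mul {p q : DiffRat} {k l : ℤ} (hp : HasIntDegree p k) (hq : HasIntDegree q l) :
    HasIntDegree (p * q) (k + l) := by
  obtain ⟨F₁, G₁, n₁, m₁, hG₁, hF₁, hH₁, hk₁, h₁⟩ := hp
  obtain ⟨F₂, G₂, n₂, m₂, hG₂, hF₂, hH₂, hk₂, h₂⟩ := hq
  refine ⟨F₁ * F₂, G₁ * G₂, n₁ + n₂, m₁ + m₂, mul_mem hG₁ hG₂, hF₁.mul hF₂, hH₁.mul hH₂,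
    by push_cast; omega, ?_⟩
  simp only [map_mul, ← h₁, ← h₂]
  ring

lemma hasIntDegree_fn (f : SmoothFun) : HasIntDegree (fn f) 0 := by
  simpa [fn] using hasIntDegree_algebraMap (MvPolynomial.isWeightedHomogeneous_C jetDegree f)

lemma HasIntDegree.smul {p : DiffRat} {k : ℤ} (hp : HasIntDegree p k) (r : ℝ) :
    HasIntDegree (r • p) k := by
  have : r • p = fn (r • 1) * p := by rw [fn_smul, fn_one, smul_one_mul]
  simpa [this] using (hasIntDegree_fn (r • 1)).mul hp

lemma HasIntDegree.neg {p : DiffRat} {k : ℤ} (hp : HasIntDegree p k) : HasIntDegree (-p) k := by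
  simpa using hp.smul (-1)

lemma HasIntDegree.sub {p q : DiffRat} {k : ℤ} (hp : HasIntDegree p k) (hq : HasIntDegree q k) :
    HasIntDegree (p - q) k := by
  simpa [sub_eq_add_neg] using hp.add hq.neg

lemma HasIntDegree.pow {p : DiffRat} {k : ℤ} (hp : HasIntDegree p k) (n : ℕ) :
    HasIntDegree (p ^ n) (n * k) := by
  induction n with
  | zero => simpa using hasIntDegree_fn 1
  | succ n ih => simpa [pow_succ, add_mul] using ih.mul hp

lemma HasIntDegree.sum {ι : Type*} {S : Finset ι} {p : ι → DiffRat} {k : ℤ}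
    (h : ∀ i ∈ S, HasIntDegree (p i) k) : HasIntDegree (∑ i ∈ S, p i) k := by
  classical
  induction S using Finset.induction_on with
  | empty => simpa using hasIntDegree_zero k
  | insert a S ha ih =>
    rw [Finset.sum_insert ha]
    exact (h a (by simp)).add (ih fun i hi => h i (by simp [hi]))

lemma hasIntDegree_jet (n : ℕ) : HasIntDegree (jet n) n := by
  cases n with
  | zero => exact hasIntDegree_fn _
  | succ n => exact hasIntDegree_algebraMap (MvPolynomial.isWeightedHomogeneous_X _ jetDegree n)

lemma hasIntDegree_uxInv : HasIntDegree uxInv (-1) := by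
  refine ⟨1, MvPolynomial.X 0, 0, 1, X_mem_nonZeroDivisors 0,
    MvPolynomial.isWeightedHomogeneous_one _ _, MvPolynomial.isWeightedHomogeneous_X _ jetDegree 0,
    by simp, ?_⟩
  rw [mul_comm, map_one]
  exact jet_one_mul_uxInv

lemma coeff_coeffDeriv (F : DiffPoly) (d : ℕ →₀ ℕ) :
    (coeffDeriv F).coeff d = derivFun (F.coeff d) :=
  coeff_sum_derivFun F d

/-- Stated as an addition, so that the case where the degree of F is less than s becomes a
contradiction instead of a truncated subtraction. -/
lemma weight_of_coeff_partialPoly_ne_zero {F : DiffPoly} {n : ℕ}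
    (hF : F.IsWeightedHomogeneous jetDegree n) {s : ℕ} {d : ℕ →₀ ℕ}
    (hd : (partialPoly s F).coeff d ≠ 0) : Finsupp.weight jetDegree d + s = n := by
  cases s with
  | zero =>
    refine hF fun h => hd ?_
    rw [partialPoly, coeff_coeffDeriv, h, map_zero]
  | succ s =>
    rw [partialPoly, Derivation.restrictScalars_apply, MvPolynomial.coeff_pderiv] at hd
    have := hF (left_ne_zero_of_mul hd)
    rwa [map_add, Finsupp.weight_single, one_smul, jetDegree] at this

lemma isWeightedHomogeneous_partialPoly {F : DiffPoly} {n m s : ℕ}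
    (hF : F.IsWeightedHomogeneous jetDegree n) (h : m + s = n) :
    (partialPoly s F).IsWeightedHomogeneous jetDegree m := fun d hd => by
  have := weight_of_coeff_partialPoly_ne_zero hF hd
  omega

lemma partialPoly_eq_zero {F : DiffPoly} {n s : ℕ}
    (hF : F.IsWeightedHomogeneous jetDegree n) (h : n < s) : partialPoly s F = 0 := by
  ext1 d
  by_contra hd
  have := weight_of_coeff_partialPoly_ne_zero hF hd
  omega

lemma isWeightedHomogeneous_partialPoly_mul {F G : DiffPoly} {n m l s : ℕ}
    (hF : F.IsWeightedHomogeneous jetDegree n) (hG : G.IsWeightedHomogeneous jetDegree m)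
    (h : l + s = n + m) : (partialPoly s F * G).IsWeightedHomogeneous jetDegree l := by
  rcases lt_or_ge n s with hs | hs
  · rw [partialPoly_eq_zero hF hs, zero_mul]
    exact MvPolynomial.isWeightedHomogeneous_zero _ _ _
  · obtain ⟨k, rfl⟩ := Nat.exists_eq_add_of_le' hs
    obtain rfl : l = k + m := by omega
    exact (isWeightedHomogeneous_partialPoly hF rfl).mul hG

lemma HasIntDegree.partialD {q : DiffRat} {k : ℤ} (hq : HasIntDegree q k) (s : ℕ) :
    HasIntDegree (partialD s q) (k - s) := by
  obtain ⟨F, G, n, m, hG, hF, hH, hk, h⟩ := hq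
  have h1 := congrArg (LoopSpace.partialD s) h
  rw [Derivation.leibniz, partialD_algebraMap, partialD_algebraMap, smul_eq_mul, smul_eq_mul] at h1
  -- The quotient rule would give a numerator of degree n + m - s over G². When that number is
  -- negative, F and G are both independent of u^{(s)} for degree reasons and the derivative is
  -- zero.
  rcases lt_or_ge (n + m) s with hs | hs
  · have h2 : LoopSpace.partialD s q = 0 := by
      rw [partialPoly_eq_zero hF (by omega), partialPoly_eq_zero hH (by omega), map_zero, mul_zero,
        zero_add] at h1
      exact ((IsLocalization.map_units DiffRat (⟨G, hG⟩ : DiffPoly⁰)).mul_right_eq_zero).1 h1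
    rw [h2]
    exact hasIntDegree_zero _
  · obtain ⟨l, hl⟩ := Nat.exists_eq_add_of_le' hs
    refine ⟨partialPoly s F * G + MvPolynomial.C (-1) * (partialPoly s G * F), G * G, l, m + m, mul_mem hG hG, ?_,
      hH.mul hH, by push_cast; omega, ?_⟩
    · have h2 := (MvPolynomial.isWeightedHomogeneous_C jetDegree (-1 : SmoothFun)).mul
        (isWeightedHomogeneous_partialPoly_mul hH hF (hl.symm.trans (add_comm n m)))
      rw [zero_add] at h2
      exact (isWeightedHomogeneous_partialPoly_mul hF hH hl.symm).add h2
    · simp only [map_add, map_mul, map_neg, map_one]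
      linear_combination algebraMap DiffPoly DiffRat G * h1 -
        algebraMap DiffPoly DiffRat (partialPoly s G) * h

lemma HasIntDegree.vecField {c : ℕ → DiffRat} {d : ℤ} (hc : ∀ s, HasIntDegree (c s) (s + d))
    {q : DiffRat} {k : ℤ} (hq : HasIntDegree q k) : HasIntDegree (vecField c q) (k + d) := by
  obtain ⟨N, hN⟩ := exists_partialD_eq_zero q
  rw [vecField_eq_sum hN]
  refine HasIntDegree.sum fun s _ => ?_
  convert (hc s).mul (hq.partialD s) using 1
  ring

lemma HasIntDegree.totalD {q : DiffRat} {k : ℤ} (hq : HasIntDegree q k) :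
    HasIntDegree (totalD q) (k + 1) :=
  HasIntDegree.vecField (fun s => mod_cast hasIntDegree_jet (s + 1)) hq

lemma HasIntDegree.dPow {q : DiffRat} {k : ℤ} (hq : HasIntDegree q k) (n : ℕ) :
    HasIntDegree (dPow n q) (n + k) := by
  induction n with
  | zero => simpa using hq
  | succ n ih =>
    rw [dPow_succ]
    convert ih.totalD using 1
    push_cast
    ring

lemma HasIntDegree.along {v q : DiffRat} {d k : ℤ} (hv : HasIntDegree v d) (hq : HasIntDegree q k) :
    HasIntDegree (along v q) (k + d) :=
  HasIntDegree.vecField (fun s => hv.dPow s) hq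

lemma HasIntDegree.varDeriv {q : DiffRat} {k : ℤ} (hq : HasIntDegree q k) :
    HasIntDegree (varDeriv q) k := by
  obtain ⟨N, hN⟩ := exists_partialD_eq_zero q
  rw [varDeriv_eq_frechetAdj, frechetAdj_eq_sum hN]
  refine HasIntDegree.sum fun s _ => HasIntDegree.smul ?_ _
  simpa using (hq.partialD s).dPow s

lemma hasIntDegree_densityB (b : SmoothFun) : HasIntDegree (densityB b) 1 := by
  have := ((hasIntDegree_fn b).mul (hasIntDegree_jet 2)).mul hasIntDegree_uxInv
  norm_num at this
  exact this

lemma hasIntDegree_densityRho (b : SmoothFun) : HasIntDegree (densityRho b) 3 := by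
  have h1 := ((hasIntDegree_fn (derivFun b * derivFun (derivFun b))).mul
    ((hasIntDegree_jet 2).pow 2)).mul hasIntDegree_uxInv
  have h2 := ((hasIntDegree_fn (derivFun b ^ 2)).mul
    ((hasIntDegree_jet 2).pow 3)).mul (hasIntDegree_uxInv.pow 3)
  have h3 := (((hasIntDegree_fn (derivFun b ^ 2)).mul (hasIntDegree_jet 2)).mul
    (hasIntDegree_jet 3)).mul (hasIntDegree_uxInv.pow 2)
  norm_num at h1 h2 h3
  exact ((h1.smul _).add (h2.smul _)).sub (h3.smul _)

lemma isQuasiMiura_expFlow {m : ℕ} (hm : 0 < m) {X : DiffRat} (hX : HasIntDegree X m) :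
    IsQuasiMiura (expFlow m X) := by
  refine ⟨fun k => HasIntDegree.hasDegree ?_, ?_⟩
  · rw [expFlow]
    split_ifs with h
    · obtain ⟨j, rfl⟩ := h
      rw [Nat.mul_div_cancel_left j hm]
      refine HasIntDegree.smul ?_ _
      induction j with
      | zero => simpa using hasIntDegree_jet 0
      | succ j ih =>
        have := hX.along ih
        rw [← Nat.cast_add] at this
        rwa [pow_succ']
    · exact hasIntDegree_zero _
  · simp [expFlow, partialD_jet]

/-! ## Schouten brackets on closed covectors -/

/-- A bivector: a skew-adjoint operator. -/
def IsSkew (P : Bivector) : Prop := ∀ f g, functional (f * P g) = -functional (g * P f)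

/-- Differentiating the skewness identity along `v` shows that the operator with differentiated
coefficients is skew too, total derivatives being preserved by `along v`. -/
lemma IsSkew.coeffAlong {P : Bivector} (hP : IsSkew P) (v f g : DiffRat) :
    functional (f * coeffAlong v P g) = -functional (g * coeffAlong v P f) := by
  have h1 := hP f (along v g)
  have h2 := hP (along v f) g
  have h3 := hP f g
  rw [← add_eq_zero_iff_eq_neg, ← map_add, functional_eq_zero_iff] at h3
  obtain ⟨h, hh⟩ := h3
  have h4 := congrArg functional (congrArg (along v) hh)
  rw [along_totalD, functional_totalD] at h4
  simp only [map_add, Derivation.leibniz, smul_eq_mul] at h4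
  simp only [LoopSpace.coeffAlong, mul_sub, map_sub]
  rw [mul_comm (P g), mul_comm (P f)] at h4
  linear_combination (norm := abel) h4 - h1 - h2

/-- The vector field `[P, Q]` contracted with two closed covectors. -/
noncomputable def schoutenField (P Q : Bivector) (α β : DiffRat) : DiffRat :=
  vectorBracket (Q β) (P α) + vectorBracket (P β) (Q α) - Q (varDeriv (α * P β)) -
    P (varDeriv (α * Q β))

/-- Integration by parts frees γ from all operators. Closedness of α and β replaces adjoint Fréchet
derivatives by ordinary ones, so that the coefficient of γ assembles into commutators of hamiltonian
fields and hamiltonian fields of the pairings ∫αPβ, ∫αQβ. -/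
lemma functional_schouten {P Q : Bivector} (hP : IsSkew P) (hQ : IsSkew Q) {α β : DiffRat}
    (hα : IsClosedCovector α) (hβ : IsClosedCovector β) (γ : DiffRat) :
    functional (schouten P Q α β γ) = functional (γ * schoutenField P Q α β) := by
  -- Only the terms where the coefficients are differentiated along the field of γ need adjoints;
  -- the others are handled by skewness.
  have key : ∀ {P Q : Bivector}, IsSkew P → IsSkew Q → functional (α * coeffAlong (Q γ) P β) =
      functional (γ * (-Q (varDeriv (α * P β)) + Q (along (P β) α) - Q (along (P α) β))) := by
    intro P Q hP hQ
    rw [coeffAlong, mul_sub, map_sub, hP α, functional_mul_along, mul_comm (along _ β),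
      functional_mul_along, sub_neg_eq_add, mul_comm (Q γ), mul_comm (Q γ), hQ _ γ, hQ _ γ, hβ,
      show frechetAdj (P β) α = varDeriv (α * P β) - along (P β) α by
        rw [varDeriv_mul, hα]; abel]
    simp only [mul_add, mul_sub, map_add, map_sub, mul_neg, map_neg]
    abel
  rw [schouten]
  simp only [mul_add, map_add]
  rw [key hP hQ, key hQ hP, hP.coeffAlong (Q α) β γ, hQ.coeffAlong (P α) β γ]
  simp only [schoutenField, vectorBracket, coeffAlong, mul_add, mul_sub, map_add, map_sub, mul_neg,
    map_neg]
  abel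

lemma isSkew_hydro (g : DiffRat) : IsSkew (hydro g) := fun f h => by
  rw [← add_eq_zero_iff_eq_neg, ← map_add, functional_eq_zero_iff]
  refine ⟨g * f * h, ?_⟩
  simp only [hydro_apply, Derivation.leibniz, smul_eq_mul]
  algebra

lemma isSkew_lieDer_deltaPrime (X : DiffRat) : IsSkew (lieDer X deltaPrime) := fun f g => by
  have key : ∀ f g, functional (f * lieDer X deltaPrime g) =
      functional (totalD f * frechetAdj X g) - functional (totalD g * frechetAdj X f) := by
    intro f g
    rw [lieDer_deltaPrime, mul_neg, mul_add, map_neg, map_add, functional_mul_along,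
      functional_mul_totalD]
    abel
  rw [key, key]
  abel

lemma schouten_zero_left (Q : Bivector) (α β γ : DiffRat) : schouten 0 Q α β γ = 0 := by
  simp [schouten, coeffAlong]

lemma schouten_comm (P Q : Bivector) (α β γ : DiffRat) :
    schouten P Q α β γ = schouten Q P α β γ := by
  simp only [schouten]
  ring

/-! ## Nondegeneracy of the pairing -/

/-- The leading term of an iterated total derivative. -/
lemma partialD_dPow_of_le {q : DiffRat} {k : ℕ} (hk : ∀ s, k < s → partialD s q = 0) (n : ℕ) :
    (∀ s, k + n < s → partialD s (dPow n q) = 0) ∧ partialD (k + n) (dPow n q) = partialD k q := by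
  induction n with
  | zero => simpa using hk
  | succ n ih =>
    rw [dPow_succ]
    refine ⟨?_, ?_⟩
    · rintro (_ | s) hs
      · omega
      · rw [partialD_totalD_succ, ih.1 s (by omega), ih.1 (s + 1) (by omega), map_zero, add_zero]
    · rw [← add_assoc, partialD_totalD_succ, ih.1 (k + n + 1) (by omega), map_zero, zero_add, ih.2]

/-- The pairing of covectors and vector fields is nondegenerate. -/
lemma eq_zero_of_functional_mul {q : DiffRat}
    (h : ∀ γ : DiffPoly, functional (algebraMap DiffPoly DiffRat γ * q) = 0) : q = 0 := by
  have hjet : ∀ n f, frechetAdj (jet n) f = (-1 : ℝ) ^ n • dPow n f := fun n f => by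
    have h1 : dPow n (jet 0) = jet n := by rw [dPow_jet, zero_add]
    rw [← h1, frechetAdj_dPow, frechetAdj_jet_zero, Module.End.one_apply]
  -- Taking γ = u^{(n)}: the functional ∫u^{(n)} q vanishes, hence so does its variational
  -- derivative.
  have hv : ∀ n, (-1 : ℝ) ^ n • dPow n q + frechetAdj q (jet n) = 0 := fun n => by
    have h1 : functional (jet n * q) = functional 0 := by
      rw [map_zero]
      cases n <;> exact h _
    have h2 := varDeriv_congr h1
    rwa [varDeriv_mul, hjet, varDeriv_eq_frechetAdj, frechetAdj_zero] at h2
  -- If q has order at most k, take n = k + 2 and differentiate by u^{(2k+2)}. The shift exceeds k,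
  -- so u^{(k+2)} is independent of q, and it is even, so the two leading terms carry equal signs
  -- and add up to 2(-1)^k ∂q/∂u^{(k)}.
  have hd : ∀ k, (∀ s, k < s → partialD s q = 0) → partialD k q = 0 := by
    intro k hk
    have hN : ∀ s, k + 1 ≤ s → partialD s q = 0 := fun s hs => hk s hs
    have hs : ∀ s, (∀ t, k + 2 < t → partialD t (partialD s q * jet (k + 2)) = 0) ∧
        partialD (k + 2) (partialD s q * jet (k + 2)) = partialD s q := fun s => by
      have h2 : ∀ t, k < t → partialD t (partialD s q) = 0 := fun t ht => by
        rw [partialD_comm, hk t ht, map_zero]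
      refine ⟨fun t ht => ?_, ?_⟩
      · simp [Derivation.leibniz, h2 t (by omega), partialD_jet, ht.ne']
      · simp [Derivation.leibniz, h2 (k + 2) (by omega), partialD_jet]
    have h := congrArg (partialD (k + 2 + k)) (hv (k + 2))
    have h3 : ∑ s ∈ Finset.range k, partialD (k + 2 + k)
        ((-1 : ℝ) ^ s • dPow s (partialD s q * jet (k + 2))) = 0 :=
      Finset.sum_eq_zero fun s hsk => by
        rw [Derivation.map_smul, (partialD_dPow_of_le (hs s).1 s).1 _
          (by have := Finset.mem_range.1 hsk; omega), smul_zero]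
    rw [frechetAdj_eq_sum hN, map_add, map_zero, map_sum, Finset.sum_range_succ, h3, zero_add,
      Derivation.map_smul, Derivation.map_smul, (partialD_dPow_of_le (hs k).1 k).2, (hs k).2,
      add_comm (k + 2) k, (partialD_dPow_of_le hk (k + 2)).2, pow_add, ← add_smul] at h
    have h4 : (-1 : ℝ) ^ k * (-1) ^ 2 + (-1) ^ k ≠ 0 := by
      rcases neg_one_pow_eq_or ℝ k with h | h <;> norm_num [h]
    exact (smul_eq_zero_iff_right h4).1 h
  have hall : ∀ s, partialD s q = 0 := by
    obtain ⟨N, hN⟩ := exists_partialD_eq_zero q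
    induction N with
    | zero => exact fun s => hN s s.zero_le
    | succ N ih =>
      refine ih fun s hs => ?_
      rcases hs.eq_or_lt with rfl | hs
      · exact hd _ hN
      · exact hN s hs
  have h0 := hv 0
  rw [frechetAdj_eq_sum (N := 0) fun s _ => hall s] at h0
  simpa using h0

/-! ## Differential polynomials of degree four -/

/-- The homogeneous differential polynomials of degree four. -/
lemma exists_eq_of_isWeightedHomogeneous_four {X : DiffPoly}
    (hX : X.IsWeightedHomogeneous jetDegree 4) : ∃ f g h i j : SmoothFun,
    algebraMap DiffPoly DiffRat X = fn f * jet 4 + fn g * (jet 1 * jet 3) + fn h * jet 2 ^ 2 +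
      fn i * (jet 1 ^ 2 * jet 2) + fn j * jet 1 ^ 4 := by
  rw [X.as_sum, map_sum]
  refine Finset.sum_induction _ (fun q => ∃ f g h i j : SmoothFun, q = fn f * jet 4 +
    fn g * (jet 1 * jet 3) + fn h * jet 2 ^ 2 + fn i * (jet 1 ^ 2 * jet 2) + fn j * jet 1 ^ 4)
    ?_ ?_ ?_
  · rintro _ _ ⟨f, g, h, i, j, rfl⟩ ⟨f', g', h', i', j', rfl⟩
    refine ⟨f + f', g + g', h + h', i + i', j + j', ?_⟩
    simp only [fn_add]
    ring
  · exact ⟨0, 0, 0, 0, 0, by simp⟩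
  · intro d hd
    have hw := hX (MvPolynomial.mem_support_iff.1 hd)
    generalize MvPolynomial.coeff d X = a
    have hle : ∀ n, d n * (n + 1) ≤ 4 := fun n => by
      rw [← hw, ← Finsupp.single_add_erase n d, map_add, Finsupp.weight_single]
      simp [jetDegree]
    have hd4 : ∀ n, 4 ≤ n → d n = 0 := fun n hn => by
      by_contra h
      have := hle n
      have : 1 ≤ d n := Nat.one_le_iff_ne_zero.2 h
      nlinarith
    have hdd : d = Finsupp.single 0 (d 0) + Finsupp.single 1 (d 1) + Finsupp.single 2 (d 2) +
        Finsupp.single 3 (d 3) := by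
      ext n
      rcases lt_or_ge n 4 with hn | hn
      · interval_cases n <;> simp
      · have h0 : n ≠ 0 := by omega
        have h1 : n ≠ 1 := by omega
        have h2 : n ≠ 2 := by omega
        have h3 : n ≠ 3 := by omega
        simp [hd4 n hn, h0, h1, h2, h3]
    have hw' : d 0 + 2 * d 1 + 3 * d 2 + 4 * d 3 = 4 := by
      rw [hdd] at hw
      simp only [map_add, Finsupp.weight_single, jetDegree, smul_eq_mul] at hw
      omega
    have hm : algebraMap DiffPoly DiffRat (MvPolynomial.monomial d a) =
        fn a * (jet 1 ^ d 0 * jet 2 ^ d 1 * jet 3 ^ d 2 * jet 4 ^ d 3) := by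
      conv_lhs => rw [hdd]
      simp only [MvPolynomial.monomial_add_single, map_mul, map_pow, fn, jet,
        ← MvPolynomial.C_mul_X_pow_eq_monomial]
      ring
    rw [hm]
    have h1 : d 1 = 0 ∨ d 1 = 1 ∨ d 1 = 2 := by omega
    have h2 : d 2 = 0 ∨ d 2 = 1 := by omega
    have h3 : d 3 = 0 ∨ d 3 = 1 := by omega
    -- The five partitions of 4.
    obtain ⟨e0, e1, e2, e3⟩ | ⟨e0, e1, e2, e3⟩ | ⟨e0, e1, e2, e3⟩ | ⟨e0, e1, e2, e3⟩ |
        ⟨e0, e1, e2, e3⟩ : (d 0 = 0 ∧ d 1 = 0 ∧ d 2 = 0 ∧ d 3 = 1) ∨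
        (d 0 = 1 ∧ d 1 = 0 ∧ d 2 = 1 ∧ d 3 = 0) ∨ (d 0 = 0 ∧ d 1 = 2 ∧ d 2 = 0 ∧ d 3 = 0) ∨
        (d 0 = 2 ∧ d 1 = 1 ∧ d 2 = 0 ∧ d 3 = 0) ∨ (d 0 = 4 ∧ d 1 = 0 ∧ d 2 = 0 ∧ d 3 = 0) := by
      rcases h1 with h1 | h1 | h1 <;> rcases h2 with h2 | h2 <;> rcases h3 with h3 | h3 <;> omega
    · exact ⟨a, 0, 0, 0, 0, by simp [e0, e1, e2, e3]⟩
    · exact ⟨0, a, 0, 0, 0, by simp [e0, e1, e2, e3]⟩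
    · exact ⟨0, 0, a, 0, 0, by simp [e0, e1, e2, e3]⟩
    · exact ⟨0, 0, 0, a, 0, by simp [e0, e1, e2, e3]⟩
    · exact ⟨0, 0, 0, 0, a, by simp [e0, e1, e2, e3]⟩

lemma fn_injective : Function.Injective fn := fun _ _ h =>
  MvPolynomial.C_injective ℕ SmoothFun (IsLocalization.injective DiffRat (le_refl DiffPoly⁰) h)

lemma jet_one_mul_cancel {f g : DiffRat} (h : jet 1 * f = jet 1 * g) : f = g := by
  have := congrArg (uxInv * ·) h
  simp only [← mul_assoc] at this
  rwa [mul_comm uxInv, jet_one_mul_uxInv, one_mul, one_mul] at this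

/-! ## Consequences of the deformation equation -/

lemma frechetAdj_fn (f : SmoothFun) (g : DiffRat) : frechetAdj (fn f) g = g * fn (derivFun f) := by
  rw [isClosedCovector_fn, along_fn]

lemma frechetAdj_jet (n : ℕ) (f : DiffRat) : frechetAdj (jet n) f = (-1 : ℝ) ^ n • dPow n f := by
  have h1 : dPow n (jet 0) = jet n := by rw [dPow_jet, zero_add]
  rw [← h1, frechetAdj_dPow, frechetAdj_jet_zero, Module.End.one_apply]

lemma isClosedCovector_one : IsClosedCovector 1 := by simpa using isClosedCovector_fn 1

lemma isClosedCovector_jet_zero : IsClosedCovector (jet 0) := isClosedCovector_fn _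

/-- The deformation equation, contracted with two closed covectors. -/
lemma schoutenField_add_eq_zero {X₂ X₄ : DiffRat} {P : ℕ → Bivector} (h0 : P 0 = hydro (jet 0))
    (h1 : P 1 = 0) (h2 : P 2 = lieDer X₂ deltaPrime) (h3 : P 3 = 0)
    (h4 : P 4 = lieDer X₄ deltaPrime) (h : SchoutenVanishes 4 P P) (α β : DiffPoly)
    (hα : IsClosedCovector (algebraMap DiffPoly DiffRat α))
    (hβ : IsClosedCovector (algebraMap DiffPoly DiffRat β)) :
    (2 : ℝ) • schoutenField (P 0) (P 4) (algebraMap DiffPoly DiffRat α)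
        (algebraMap DiffPoly DiffRat β) +
      schoutenField (P 2) (P 2) (algebraMap DiffPoly DiffRat α) (algebraMap DiffPoly DiffRat β)
        = 0 := by
  refine eq_zero_of_functional_mul fun γ => ?_
  have h5 := functional_eq_zero_iff.2 (h 4 le_rfl α β γ)
  have hs0 : IsSkew (P 0) := h0 ▸ isSkew_hydro _
  have hs2 : IsSkew (P 2) := h2 ▸ isSkew_lieDer_deltaPrime _
  have hs4 : IsSkew (P 4) := h4 ▸ isSkew_lieDer_deltaPrime _
  -- Only the pairs (0,4), (2,2), (4,0) survive; the outer two coincide by symmetry of the bracket,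
  -- whence the factor 2.
  simp only [Finset.Nat.antidiagonal_succ, Finset.Nat.antidiagonal_zero,
    Finset.map_singleton, Finset.sum_cons, Finset.sum_singleton, Finset.map_cons,
    Function.Embedding.prodMap, Function.Embedding.coeFn_mk, Prod.map,
    Function.Embedding.refl_apply, Nat.succ_eq_add_one, zero_add, Nat.reduceAdd, h1, h3,
    schouten_zero_left, schouten_comm (P 4) (P 0), map_add,
    functional_schouten hs0 hs4 hα hβ, functional_schouten hs2 hs2 hα hβ] at h5
  rw [mul_add, map_add, mul_smul_comm, map_smul]
  linear_combination (norm := module) h5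

lemma hydro_one : hydro (jet 0) 1 = (1 / 2 : ℝ) • jet 1 := by
  simp [hydro_apply]

lemma hydro_jet_zero : hydro (jet 0) (jet 0) = (3 / 2 : ℝ) • (jet 0 * jet 1) := by
  rw [hydro_apply, totalD_jet]
  algebra

lemma lieDer_deltaPrime_one (X : DiffRat) : lieDer X deltaPrime 1 = -totalD (varDeriv X) := by
  rw [lieDer_deltaPrime, Derivation.map_one_eq_zero, along_zero, zero_add, varDeriv_eq_frechetAdj]

lemma lieDer_deltaPrime_jet_zero (X : DiffRat) :
    lieDer X deltaPrime (jet 0) = -totalD (X + frechetAdj X (jet 0)) := by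
  rw [lieDer_deltaPrime, totalD_jet, along_jet_one, map_add]

/-- The field u_x generates translations in x, hence is central among translation invariant fields.
-/
lemma vectorBracket_jet_one (V : DiffRat) : vectorBracket V (jet 1) = 0 := by
  rw [vectorBracket, along_jet_one, along_jet, dPow_succ, dPow_zero, sub_self]

lemma vectorBracket_smul (r : ℝ) (V W : DiffRat) :
    vectorBracket V (r • W) = r • vectorBracket V W := by
  simp only [vectorBracket, Derivation.map_smul, along_smul, smul_sub]

/-- The hamiltonian fields of the covectors 1 and u are ½u_x, which is central, and (3/2)u u_x, the
Hopf flow. The hamiltonian corrections vanish, their functionals being total derivatives. What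
remains is the Hopf flow acting on δX/δu. -/
lemma schoutenField_hydro_one_jet_zero (X : DiffRat) :
    schoutenField (hydro (jet 0)) (lieDer X deltaPrime) 1 (jet 0) = -((3 / 2 : ℝ) •
      totalD (along (jet 0 * jet 1) (varDeriv X) - jet 0 * totalD (varDeriv X))) := by
  have h1 : jet 0 * jet 1 = totalD ((1 / 2 : ℝ) • jet 0 ^ 2) := by
    rw [Derivation.map_smul, pow_two, Derivation.leibniz, totalD_jet, smul_eq_mul]
    algebra
  rw [schoutenField, lieDer_deltaPrime_one, lieDer_deltaPrime_jet_zero, one_mul, one_mul,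
    hydro_one, hydro_jet_zero, vectorBracket_smul, vectorBracket_jet_one, varDeriv_neg, varDeriv_totalD,
    h1, varDeriv_smul, varDeriv_totalD, ← h1]
  simp only [vectorBracket, along_smul, Derivation.map_smul, map_neg, along_totalD, map_sub,
    map_zero, smul_zero, Derivation.leibniz, smul_eq_mul, along_jet,
    dPow_succ, dPow_zero, totalD_jet]
  algebra

/-- When δX/δu = 0 the bivector d₁X annihilates the covector 1, and its value on u is a total
derivative, so no term survives. -/
lemma schoutenField_self_one_jet_zero {X : DiffRat} (hX : varDeriv X = 0) :
    schoutenField (lieDer X deltaPrime) (lieDer X deltaPrime) 1 (jet 0) = 0 := by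
  rw [schoutenField, lieDer_deltaPrime_one, lieDer_deltaPrime_jet_zero, hX, one_mul, ← map_neg,
    varDeriv_totalD]
  simp [vectorBracket]

lemma secondOrderField_eq (s : SmoothFun) : secondOrderField s = totalD (fn s * jet 1) := by
  simp only [secondOrderField, Derivation.leibniz, totalD_fn, totalD_jet, smul_eq_mul]
  ring

/-- A function in the kernel of the total derivative does not depend on the jet variables. -/
lemma partialD_eq_zero_of_totalD {f : DiffRat} (h : totalD f = 0) (s : ℕ) : partialD s f = 0 := by
  obtain ⟨N, hN⟩ := exists_partialD_eq_zero f
  induction N generalizing s with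
  | zero => exact hN s s.zero_le
  | succ N ih =>
    refine ih s fun t ht => ?_
    rcases ht.eq_or_lt with rfl | ht
    · have h1 := partialD_totalD_succ N f
      rw [h, hN (N + 1) le_rfl, map_zero, map_zero, zero_add] at h1
      exact h1.symm
    · exact hN t ht

/-- A scalar of degree four invariant under the Hopf flow has no terms linear in `u_xxxx` and no
term proportional to `u_x² u_xx`. -/
lemma eq_zero_of_hopf {a b c d r : SmoothFun} {e : DiffRat} (he : e = fn a * jet 4 +
    fn b * (jet 1 * jet 3) + fn c * jet 2 ^ 2 + fn d * (jet 1 ^ 2 * jet 2) + fn r * jet 1 ^ 4)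
    (h : totalD (along (jet 0 * jet 1) e - jet 0 * totalD e) = 0) : a = 0 ∧ d = 0 := by
  have h1 : along (jet 0 * jet 1) e - jet 0 * totalD e = (5 : ℝ) • (fn a * (jet 1 * jet 4)) +
      (5 : ℝ) • (fn b * (jet 1 ^ 2 * jet 3)) + (5 : ℝ) • (fn d * (jet 1 ^ 3 * jet 2))
      + (4 : ℝ) • (fn r * jet 1 ^ 5) + (10 : ℝ) • (fn a * (jet 2 * jet 3)) +
      (3 : ℝ) • (fn b * (jet 1 * jet 2 ^ 2)) + (6 : ℝ) • (fn c * (jet 1 * jet 2 ^ 2)) := by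
    subst he
    simp only [map_add, Derivation.leibniz, Derivation.leibniz_pow, smul_eq_mul, nsmul_eq_mul, Nat.cast_ofNat, along_fn,
      along_jet, dPow_succ, dPow_zero, totalD_fn, totalD_jet, Nat.reduceAdd]
    algebra
  rw [h1] at h
  -- The expression inside ∂_x is independent of every jet variable; its coefficients are peeled off
  -- from the highest derivative downwards.
  have h4 := partialD_eq_zero_of_totalD h 4
  simp [partialD_jet, Derivation.leibniz, Derivation.leibniz_pow] at h4
  have ha : fn a = 0 := jet_one_mul_cancel (by linear_combination h4)
  have h3 := partialD_eq_zero_of_totalD h 3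
  simp [partialD_jet, Derivation.leibniz, Derivation.leibniz_pow, ha] at h3
  have hb : fn b = 0 := jet_one_mul_cancel (jet_one_mul_cancel (by linear_combination h3))
  have h2 := partialD_eq_zero_of_totalD h 2
  simp [partialD_jet, Derivation.leibniz, Derivation.leibniz_pow, ha, hb] at h2
  have hc : fn c = 0 := by
    have h2' : (5 : ℝ) • (fn d * jet 1 ^ 3) + (12 : ℝ) • (fn c * (jet 1 * jet 2)) = 0 := by
      rw [← h2]
      algebra
    have h22 := congrArg (partialD 2) h2'
    simp [partialD_jet, Derivation.leibniz, Derivation.leibniz_pow] at h22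
    exact jet_one_mul_cancel (by linear_combination h22)
  have hd : fn d = 0 := by
    rw [hc] at h2
    refine jet_one_mul_cancel (jet_one_mul_cancel (jet_one_mul_cancel ?_))
    simp at h2
    linear_combination h2
  exact ⟨fn_injective (by rw [ha, fn_zero]), fn_injective (by rw [hd, fn_zero])⟩

/-- For X = ∂h the bivector d₁X is -∂ ∘ (h_* - h_*†) ∘ ∂, so it sees only the skew part of the
Fréchet derivative of `h`. -/
lemma lieDer_totalD_deltaPrime_apply (h f : DiffRat) : lieDer (totalD h) deltaPrime f =
    -totalD (along (totalD f) h - frechetAdj h (totalD f)) := by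
  rw [lieDer_deltaPrime, along_totalD, frechetAdj_totalD, map_sub, map_neg, sub_eq_add_neg]

lemma lieDer_secondOrderField_deltaPrime (s : SmoothFun) (f : DiffRat) :
    lieDer (secondOrderField s) deltaPrime f =
      -totalD (fn s * dPow 2 f + totalD (fn s * totalD f)) := by
  rw [secondOrderField_eq, lieDer_totalD_deltaPrime_apply]
  simp only [Derivation.leibniz, smul_eq_mul, along_fn, along_jet, frechetAdj_mul, frechetAdj_fn,
    frechetAdj_jet, dPow_succ, dPow_zero, pow_one, neg_one_smul, totalD_fn]
  ring_nf

/-- The leading coefficients of `δ'`-exact bivectors of degree four. -/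
lemma lieDer_cubicField_deltaPrime (k l m n : SmoothFun) (hn : n = derivFun l - (3 : ℝ) • m)
    (f : DiffRat) : lieDer (totalD (fn k * jet 3 + fn l * (jet 1 * jet 2) + fn m * jet 1 ^ 3))
      deltaPrime f = -totalD (fn k * dPow 4 f + dPow 3 (fn k * totalD f) -
        (fn n * (jet 1 ^ 2 * dPow 2 f) + totalD (fn n * (jet 1 ^ 2 * totalD f)))) := by
  have hn' : fn n = fn (derivFun l) - (3 : ℝ) • fn m := by
    rw [hn, sub_eq_add_neg, ← neg_smul, fn_add, fn_smul, neg_smul, sub_eq_add_neg]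
  rw [lieDer_totalD_deltaPrime_apply, hn']
  congr 2
  simp only [map_add, map_sub, Derivation.map_smul, frechetAdj_add, Derivation.leibniz, smul_eq_mul,
    along_fn, along_jet, frechetAdj_mul, frechetAdj_fn, pow_succ, pow_zero, one_mul,
    frechetAdj_jet, dPow_succ, dPow_zero, totalD_fn, totalD_jet, mul_neg_one, neg_smul, one_smul,
    neg_neg, Nat.reduceAdd]
  algebra

lemma fn_jet_zero :
    fn ⟨fun x => x, show ContDiff ℝ ∞ fun x : ℝ => x from contDiff_id⟩ = jet 0 := rfl

lemma fn_sub (f g : SmoothFun) : fn (f - g) = fn f - fn g := by simp [fn]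

lemma vectorBracket_comm (V W : DiffRat) : vectorBracket V W = -vectorBracket W V :=
  (neg_sub _ _).symm

lemma vectorBracket_neg (V W : DiffRat) : vectorBracket V (-W) = -vectorBracket V W := by
  rw [← neg_one_smul ℝ W, vectorBracket_smul, neg_one_smul]

/-- Commutators with f(u)u_x preserve the image of ∂_x, so the computations with `totalD q` can be
done on `q`, at one order of differentiation less. -/
lemma vectorBracket_mul_jet_one_totalD (f : SmoothFun) (q : DiffRat) :
    vectorBracket (fn f * jet 1) (totalD q) =
      totalD (along (fn f * jet 1) q - fn f * totalD q) := by
  simp only [vectorBracket, along_totalD, map_sub, Derivation.leibniz, smul_eq_mul, along_fn,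
    along_jet, dPow_succ, dPow_zero, totalD_fn]
  ring

/-- The hamiltonian fields of u and u² for u∂ + ½u_x are (3/2)u u_x and (5/2)u² u_x. Apart from the
common term u·e, their action on the potentials of P(u) and P(u²) gives r and 2r, and -e is the
variational derivative of ∫u P(u²). All terms with an explicit factor u then cancel. -/
lemma schoutenField_hydro_quadratic {k n : SmoothFun} {P : Bivector} {e r : DiffRat}
    (hP : ∀ f, P f = -totalD (fn k * dPow 4 f + dPow 3 (fn k * totalD f) -
        (fn n * (jet 1 ^ 2 * dPow 2 f) + totalD (fn n * (jet 1 ^ 2 * totalD f)))))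
    (he : e = (20 : ℝ) • (fn k * (jet 1 * jet 4)) + (40 : ℝ) • (fn k * (jet 2 * jet 3)) +
      (60 : ℝ) • (fn (derivFun k) * (jet 1 * jet 2 ^ 2)) +
      (40 : ℝ) • (fn (derivFun k) * (jet 1 ^ 2 * jet 3)) +
      (60 : ℝ) • (fn (derivFun (derivFun k)) * (jet 1 ^ 3 * jet 2)) +
      (8 : ℝ) • (fn (derivFun (derivFun (derivFun k))) * jet 1 ^ 5) -
      (40 : ℝ) • (fn n * (jet 1 ^ 3 * jet 2)) - (8 : ℝ) • (fn (derivFun n) * jet 1 ^ 5))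
    (hr : r = (60 : ℝ) • (fn k * (jet 1 * jet 2 ^ 2)) + (40 : ℝ) • (fn k * (jet 1 ^ 2 * jet 3)) +
      (60 : ℝ) • (fn (derivFun k) * (jet 1 ^ 3 * jet 2)) +
      (12 : ℝ) • (fn (derivFun (derivFun k)) * jet 1 ^ 5) - (8 : ℝ) • (fn n * jet 1 ^ 5)) :
    (2 : ℝ) • schoutenField (hydro (jet 0)) P (jet 0) (jet 0 ^ 2) = totalD r - jet 1 * e := by
  have hPu : P (jet 0) = -totalD ((2 : ℝ) • (fn k * jet 4) +
      (4 : ℝ) • (fn (derivFun k) * (jet 1 * jet 3)) + (3 : ℝ) • (fn (derivFun k) * jet 2 ^ 2) +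
      (6 : ℝ) • (fn (derivFun (derivFun k)) * (jet 1 ^ 2 * jet 2)) +
      fn (derivFun (derivFun (derivFun k))) * jet 1 ^ 4 -
      (4 : ℝ) • (fn n * (jet 1 ^ 2 * jet 2)) - fn (derivFun n) * jet 1 ^ 4) := by
    rw [hP]
    congr 2
    simp only [map_add, Derivation.leibniz, smul_eq_mul, dPow_succ, dPow_zero, totalD_fn,
      totalD_jet, pow_succ, pow_zero, one_mul, Nat.reduceAdd]
    algebra
  have hPg : P (jet 0 ^ 2) = -totalD ((4 : ℝ) • (fn k * (jet 0 * jet 4)) +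
      (16 : ℝ) • (fn k * (jet 1 * jet 3)) + (12 : ℝ) • (fn k * jet 2 ^ 2) +
      (8 : ℝ) • (fn (derivFun k) * (jet 0 * jet 1 * jet 3)) +
      (6 : ℝ) • (fn (derivFun k) * (jet 0 * jet 2 ^ 2)) +
      (24 : ℝ) • (fn (derivFun k) * (jet 1 ^ 2 * jet 2)) +
      (12 : ℝ) • (fn (derivFun (derivFun k)) * (jet 0 * jet 1 ^ 2 * jet 2)) +
      (6 : ℝ) • (fn (derivFun (derivFun k)) * jet 1 ^ 4) +
      (2 : ℝ) • (fn (derivFun (derivFun (derivFun k))) * (jet 0 * jet 1 ^ 4)) -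
      (8 : ℝ) • (fn n * (jet 0 * jet 1 ^ 2 * jet 2)) - (4 : ℝ) • (fn n * jet 1 ^ 4) -
      (2 : ℝ) • (fn (derivFun n) * (jet 0 * jet 1 ^ 4))) := by
    rw [hP]
    congr 2
    simp only [map_add, Derivation.leibniz, smul_eq_mul, dPow_succ, dPow_zero, totalD_fn,
      totalD_jet, pow_succ, pow_zero, one_mul, Nat.reduceAdd]
    algebra
  have hEP : varDeriv (jet 0 * P (jet 0 ^ 2)) = -e := by
    have h1 : functional (jet 0 * P (jet 0 ^ 2)) = functional (-((10 : ℝ) • (fn k *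
        (jet 1 * jet 2 ^ 2))) + (2 : ℝ) • (fn (derivFun (derivFun k)) * jet 1 ^ 5) -
        (2 : ℝ) • (fn n * jet 1 ^ 5)) := by
      rw [hPg, ← sub_eq_zero, ← map_neg, functional_mul_totalD, ← map_neg, ← map_sub,
        functional_eq_zero_iff]
      -- The primitive removes by parts u_xxxx, u_xxx and the explicit factor u, leaving a density
      -- of second order whose variation is short.
      refine ⟨fn k * ((4 : ℝ) • (jet 0 * jet 1 * jet 3) - (2 : ℝ) • (jet 0 * jet 2 ^ 2) +
        (12 : ℝ) • (jet 1 ^ 2 * jet 2)) + fn (derivFun k) * ((4 : ℝ) • (jet 0 * jet 1 ^ 2 * jet 2) +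
        (2 : ℝ) • jet 1 ^ 4) + (2 : ℝ) • (fn (derivFun (derivFun k)) * (jet 0 * jet 1 ^ 4)) -
        (2 : ℝ) • (fn n * (jet 0 * jet 1 ^ 4)), ?_⟩
      simp only [map_add, map_sub, Derivation.leibniz, Derivation.map_smul, smul_eq_mul, totalD_fn,
        totalD_jet, pow_succ, pow_zero, one_mul, Nat.reduceAdd]
      algebra
    rw [varDeriv_congr h1, varDeriv_eq_frechetAdj, he]
    simp only [map_add, Derivation.leibniz, smul_eq_mul, frechetAdj_add, frechetAdj_sub,
      frechetAdj_neg, frechetAdj_smul, frechetAdj_mul, frechetAdj_fn, pow_succ, pow_zero, one_mul,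
      frechetAdj_jet, dPow_succ, dPow_zero, totalD_fn, totalD_jet, mul_neg_one, neg_smul, one_smul,
      neg_neg, Derivation.map_one_eq_zero, map_zero, Nat.reduceAdd]
    algebra
  have hHg : hydro (jet 0) (jet 0 ^ 2) = (5 / 2 : ℝ) • (jet 0 ^ 2 * jet 1) := by
    rw [hydro_apply, pow_two, Derivation.leibniz, totalD_jet, smul_eq_mul]
    algebra
  have hEH : varDeriv (jet 0 * hydro (jet 0) (jet 0 ^ 2)) = 0 := by
    have h1 : jet 0 * hydro (jet 0) (jet 0 ^ 2) = totalD ((5 / 8 : ℝ) • jet 0 ^ 4) := by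
      rw [hHg]
      simp only [Derivation.map_smul, Derivation.leibniz, pow_succ, pow_zero, one_mul, smul_eq_mul,
        totalD_jet]
      algebra
    rw [h1, varDeriv_totalD]
  -- Only the action on the potential of P(u) is retained; its explicit form is hidden to keep the
  -- final bracket computation small.
  have hu : ∃ q, P (jet 0) = -totalD q ∧
      along (jet 0 ^ 2 * jet 1) q - jet 0 ^ 2 * totalD q = jet 0 * e + r := by
    refine ⟨_, hPu, ?_⟩
    rw [he, hr]
    simp only [map_add, map_sub, Derivation.map_smul, Derivation.leibniz, smul_eq_mul, along_fn,
      along_jet, dPow_succ, dPow_zero, pow_succ, pow_zero, one_mul, totalD_fn, totalD_jet,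
      Nat.reduceAdd]
    algebra
  have hg : ∃ q, P (jet 0 ^ 2) = -totalD q ∧
      along (jet 0 * jet 1) q - jet 0 * totalD q = jet 0 * e + (2 : ℝ) • r := by
    refine ⟨_, hPg, ?_⟩
    rw [he, hr]
    simp only [map_add, map_sub, Derivation.map_smul, Derivation.leibniz, smul_eq_mul, along_fn,
      along_jet, dPow_succ, dPow_zero, pow_succ, pow_zero, one_mul, totalD_fn, totalD_jet,
      Nat.reduceAdd]
    algebra
  obtain ⟨q, hq, hqr⟩ := hu
  obtain ⟨q', hq', hqr'⟩ := hg
  have h2 : vectorBracket (jet 0 ^ 2 * jet 1) (totalD q) = totalD (jet 0 * e + r) := by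
    rw [← hqr, ← fn_jet_zero, ← fn_pow, vectorBracket_mul_jet_one_totalD]
  have h1 : vectorBracket (jet 0 * jet 1) (totalD q') = totalD (jet 0 * e + (2 : ℝ) • r) := by
    rw [← hqr', ← fn_jet_zero, vectorBracket_mul_jet_one_totalD]
  have h3 : vectorBracket (-totalD q') ((3 / 2 : ℝ) • (jet 0 * jet 1)) =
      (3 / 2 : ℝ) • totalD (jet 0 * e + (2 : ℝ) • r) := by
    rw [vectorBracket_smul, vectorBracket_comm, vectorBracket_neg, neg_neg, h1]
  have h4 : vectorBracket ((5 / 2 : ℝ) • (jet 0 ^ 2 * jet 1)) (-totalD q) =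
      -((5 / 2 : ℝ) • totalD (jet 0 * e + r)) := by
    rw [vectorBracket_neg, vectorBracket_comm, vectorBracket_smul, ← h2,
      vectorBracket_comm (totalD q), smul_neg, neg_neg]
  rw [schoutenField, hEP, hEH, hHg, hydro_jet_zero, hq, hq', map_zero, sub_zero, h3, h4,
    hydro_apply]
  simp only [map_add, map_neg, Derivation.leibniz, Derivation.map_smul, smul_eq_mul, totalD_jet]
  algebra

/-- Each term lies in the image of ∂_x: the commutator because Q(u) and Q(u²) are total derivatives,
the hamiltonian correction because Q begins with ∂. The computation takes place on the potentials.
-/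
lemma schoutenField_self_quadratic {s : SmoothFun} {Q : Bivector}
    (hQ : ∀ f, Q f = -totalD (fn s * dPow 2 f + totalD (fn s * totalD f))) :
    schoutenField Q Q (jet 0) (jet 0 ^ 2) = (2 : ℝ) • totalD (
      (60 : ℝ) • (fn s * fn (derivFun s) * (jet 1 * jet 2 ^ 2)) +
      (20 : ℝ) • (fn s * fn (derivFun s) * (jet 1 ^ 2 * jet 3)) +
      (40 : ℝ) • (fn s * fn (derivFun (derivFun s)) * (jet 1 ^ 3 * jet 2)) +
      (4 : ℝ) • (fn s * fn (derivFun (derivFun (derivFun s))) * jet 1 ^ 5) +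
      (12 : ℝ) • (fn (derivFun s) * fn (derivFun (derivFun s)) * jet 1 ^ 5) +
      (40 : ℝ) • (fn (derivFun s) ^ 2 * (jet 1 ^ 3 * jet 2))) := by
  have hQu : Q (jet 0) = -totalD ((2 : ℝ) • (fn s * jet 2) + fn (derivFun s) * jet 1 ^ 2) := by
    rw [hQ]
    congr 2
    simp only [Derivation.leibniz, smul_eq_mul, dPow_succ, dPow_zero, totalD_fn, totalD_jet]
    algebra
  have hQg : Q (jet 0 ^ 2) = -totalD ((4 : ℝ) • (fn s * (jet 0 * jet 2)) +
      (4 : ℝ) • (fn s * jet 1 ^ 2) + (2 : ℝ) • (fn (derivFun s) * (jet 0 * jet 1 ^ 2))) := by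
    rw [hQ]
    congr 2
    simp only [map_add, Derivation.leibniz, smul_eq_mul, dPow_succ, dPow_zero, totalD_fn,
      totalD_jet, pow_succ, pow_zero, one_mul]
    algebra
  have hEQ : varDeriv (jet 0 * Q (jet 0 ^ 2)) = -((12 : ℝ) • (fn s * (jet 1 * jet 2))) -
      (4 : ℝ) • (fn (derivFun s) * jet 1 ^ 3) := by
    have h1 : functional (jet 0 * Q (jet 0 ^ 2)) = functional ((2 : ℝ) • (fn s * jet 1 ^ 3)) := by
      rw [hQg, ← sub_eq_zero, ← map_neg, functional_mul_totalD, ← map_neg, ← map_sub,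
        functional_eq_zero_iff]
      refine ⟨(2 : ℝ) • (fn s * (jet 0 * jet 1 ^ 2)), ?_⟩
      simp only [Derivation.leibniz, Derivation.map_smul, smul_eq_mul, totalD_fn,
        totalD_jet, pow_succ, pow_zero, one_mul, Nat.reduceAdd]
      algebra
    rw [varDeriv_congr h1, varDeriv_eq_frechetAdj]
    simp only [Derivation.leibniz, smul_eq_mul,
      frechetAdj_smul, frechetAdj_mul, frechetAdj_fn, pow_succ, pow_zero, one_mul,
      frechetAdj_jet, dPow_succ, dPow_zero, totalD_fn, totalD_jet, mul_neg_one, neg_smul, one_smul,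
      Derivation.map_one_eq_zero, Nat.reduceAdd]
    algebra
  have hqq : ∃ q q', Q (jet 0) = -totalD q ∧ Q (jet 0 ^ 2) = -totalD q' ∧
      along (totalD q') q - along (totalD q) q' +
        (fn s * dPow 2 (varDeriv (jet 0 * Q (jet 0 ^ 2))) +
          totalD (fn s * totalD (varDeriv (jet 0 * Q (jet 0 ^ 2))))) =
      (60 : ℝ) • (fn s * fn (derivFun s) * (jet 1 * jet 2 ^ 2)) +
      (20 : ℝ) • (fn s * fn (derivFun s) * (jet 1 ^ 2 * jet 3)) +
      (40 : ℝ) • (fn s * fn (derivFun (derivFun s)) * (jet 1 ^ 3 * jet 2)) +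
      (4 : ℝ) • (fn s * fn (derivFun (derivFun (derivFun s))) * jet 1 ^ 5) +
      (12 : ℝ) • (fn (derivFun s) * fn (derivFun (derivFun s)) * jet 1 ^ 5) +
      (40 : ℝ) • (fn (derivFun s) ^ 2 * (jet 1 ^ 3 * jet 2)) := by
    refine ⟨_, _, hQu, hQg, ?_⟩
    rw [hEQ]
    simp only [map_add, map_sub, map_neg, Derivation.leibniz,
      Derivation.map_smul, smul_eq_mul, along_fn, along_jet, dPow_succ, dPow_zero, pow_succ,
      pow_zero, one_mul, totalD_fn, totalD_jet, Nat.reduceAdd]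
    algebra
  obtain ⟨q, q', hq, hq', h⟩ := hqq
  have h2 : vectorBracket (Q (jet 0 ^ 2)) (Q (jet 0)) =
      totalD (along (totalD q') q - along (totalD q) q') := by
    rw [hq, hq', vectorBracket]
    simp only [along_neg, map_neg, along_totalD, map_sub, neg_neg]
  rw [schoutenField, hQ (varDeriv _), h2, ← h]
  simp only [map_add, map_sub]
  module

/-- The function n cancels between ∂r and u_x e, and the terms quadratic in s combine with k into κ
and its derivatives alone. Hence this contraction tests exactly whether κ = 0. -/
lemma schoutenField_add_quadratic {k n s κ : SmoothFun} {P Q : Bivector}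
    (hκ : κ = k + (2 : ℝ) • (s * derivFun s))
    (hP : ∀ f, P f = -totalD (fn k * dPow 4 f + dPow 3 (fn k * totalD f) -
        (fn n * (jet 1 ^ 2 * dPow 2 f) + totalD (fn n * (jet 1 ^ 2 * totalD f)))))
    (hQ : ∀ f, Q f = -totalD (fn s * dPow 2 f + totalD (fn s * totalD f))) :
    (2 : ℝ) • schoutenField (hydro (jet 0)) P (jet 0) (jet 0 ^ 2) +
        schoutenField Q Q (jet 0) (jet 0 ^ 2) =
      (20 : ℝ) • (fn κ * (jet 1 ^ 2 * jet 4)) + (160 : ℝ) • (fn κ * (jet 1 * jet 2 * jet 3)) +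
      (60 : ℝ) • (fn κ * jet 2 ^ 3) + (180 : ℝ) • (fn (derivFun κ) * (jet 1 ^ 2 * jet 2 ^ 2)) +
      (60 : ℝ) • (fn (derivFun κ) * (jet 1 ^ 3 * jet 3)) +
      (60 : ℝ) • (fn (derivFun (derivFun κ)) * (jet 1 ^ 4 * jet 2)) +
      (4 : ℝ) • (fn (derivFun (derivFun (derivFun κ))) * jet 1 ^ 6) := by
  have hκ0 : fn κ = fn k + (2 : ℝ) • (fn s * fn (derivFun s)) := by
    rw [hκ, fn_add, fn_smul, fn_mul]
  have hκ1 : fn (derivFun κ) = fn (derivFun k) + (2 : ℝ) • (fn s * fn (derivFun (derivFun s)) +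
      fn (derivFun s) * fn (derivFun s)) := by
    rw [hκ]
    simp only [map_add, Derivation.map_smul, Derivation.leibniz, fn_add, fn_smul, fn_mul, smul_eq_mul]
  have hκ2 : fn (derivFun (derivFun κ)) = fn (derivFun (derivFun k)) + (2 : ℝ) •
      (fn s * fn (derivFun (derivFun (derivFun s))) +
      3 * (fn (derivFun s) * fn (derivFun (derivFun s)))) := by
    rw [hκ]
    simp only [map_add, Derivation.map_smul, Derivation.leibniz, fn_add, fn_smul, fn_mul, smul_eq_mul]
    algebra
  have hκ3 : fn (derivFun (derivFun (derivFun κ))) = fn (derivFun (derivFun (derivFun k))) +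
      (2 : ℝ) • (fn s * fn (derivFun (derivFun (derivFun (derivFun s)))) +
      4 * (fn (derivFun s) * fn (derivFun (derivFun (derivFun s)))) +
      3 * (fn (derivFun (derivFun s)) * fn (derivFun (derivFun s)))) := by
    rw [hκ]
    simp only [map_add, Derivation.map_smul, Derivation.leibniz, fn_add, fn_smul, fn_mul, smul_eq_mul]
    algebra
  rw [schoutenField_hydro_quadratic hP rfl rfl, schoutenField_self_quadratic hQ, hκ0, hκ1, hκ2, hκ3]
  simp only [map_add, map_sub, Derivation.leibniz, Derivation.map_smul, smul_eq_mul, pow_succ,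
    pow_zero, one_mul, totalD_fn, totalD_jet, Nat.reduceAdd]
  algebra

/-- The constraints imposed on a homogeneous field of degree four by the deformation equation. -/
lemma constraints_of_schoutenVanishes {s f g h i j : SmoothFun} {X₄ : DiffRat} {P : ℕ → Bivector}
    (hX : X₄ = fn f * jet 4 + fn g * (jet 1 * jet 3) + fn h * jet 2 ^ 2 +
      fn i * (jet 1 ^ 2 * jet 2) + fn j * jet 1 ^ 4) (h0 : P 0 = hydro (jet 0))
    (h1 : P 1 = 0) (h2 : P 2 = lieDer (secondOrderField s) deltaPrime) (h3 : P 3 = 0)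
    (h4 : P 4 = lieDer X₄ deltaPrime) (hP : SchoutenVanishes 4 P P) :
    f = (-2 : ℝ) • (s * derivFun s) ∧ h = g - derivFun f ∧
      (3 : ℝ) • j = derivFun (i - derivFun h) := by
  have hX2 : varDeriv (secondOrderField s) = 0 := by rw [secondOrderField_eq, varDeriv_totalD]
  have h1c : IsClosedCovector (algebraMap DiffPoly DiffRat 1) := by
    rw [map_one]
    exact isClosedCovector_one
  -- The test covectors must be polynomial; u itself is the image of a constant polynomial.
  obtain ⟨p, hp⟩ : ∃ p : DiffPoly, algebraMap DiffPoly DiffRat p = jet 0 := ⟨_, rfl⟩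
  have hpc : IsClosedCovector (algebraMap DiffPoly DiffRat p) := hp ▸ isClosedCovector_jet_zero
  have hp2 : IsClosedCovector (algebraMap DiffPoly DiffRat (p ^ 2)) := by
    rw [map_pow, hp, ← fn_jet_zero, ← fn_pow]
    exact isClosedCovector_fn _
  have hab : (2 : ℝ) • (derivFun f - g + h) = 0 ∧
      (6 : ℝ) • (derivFun (derivFun (derivFun f)) - derivFun (derivFun g)) +
        (2 : ℝ) • derivFun (derivFun h) + (4 : ℝ) • derivFun i - (12 : ℝ) • j = 0 := by
    have e1 := schoutenField_add_eq_zero h0 h1 h2 h3 h4 hP 1 p h1c hpc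
    rw [map_one, hp, h0, h2, h4, schoutenField_hydro_one_jet_zero,
      schoutenField_self_one_jet_zero hX2, add_zero] at e1
    have e2 : totalD (along (jet 0 * jet 1) (varDeriv X₄) - jet 0 * totalD (varDeriv X₄)) = 0 := by
      linear_combination (norm := module) (-1 / 3 : ℝ) • e1
    -- These are the coefficients of δX⁽⁴⁾/δu; the two that are concluded to vanish give the two
    -- constraints.
    refine eq_zero_of_hopf (b := (4 : ℝ) • (derivFun (derivFun f) - derivFun g + derivFun h))
      (c := (3 : ℝ) • (derivFun (derivFun f) - derivFun g + derivFun h))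
      (r := derivFun (derivFun (derivFun (derivFun f) - derivFun g + i)) - (3 : ℝ) • derivFun j)
      ?_ e2
    rw [hX, varDeriv_eq_frechetAdj]
    simp only [fn_add, fn_sub, fn_smul, map_add, map_sub, Derivation.leibniz, smul_eq_mul,
      frechetAdj_add, frechetAdj_mul, frechetAdj_fn, pow_succ, pow_zero, one_mul, frechetAdj_jet,
      dPow_succ, dPow_zero, totalD_fn, totalD_jet, mul_neg_one, neg_smul, one_smul, neg_neg,
      Derivation.map_one_eq_zero, map_zero, Nat.reduceAdd]
    algebra
  have hh : h = g - derivFun f := by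
    linear_combination (norm := module) (1 / 2 : ℝ) • hab.1
  have hj : (3 : ℝ) • j = derivFun (i - derivFun h) := by
    have h5 := hab.2
    have h6 : derivFun (derivFun h) = derivFun (derivFun g) - derivFun (derivFun (derivFun f)) := by
      rw [hh, map_sub, map_sub]
    rw [map_sub]
    linear_combination (norm := module) (-1 / 4 : ℝ) • h5 + (3 / 2 : ℝ) • h6
  refine ⟨?_, hh, hj⟩
  have e3 := schoutenField_add_eq_zero h0 h1 h2 h3 h4 hP p (p ^ 2) hpc hp2
  -- The two constraints already obtained say precisely that X⁽⁴⁾ is a total derivative, which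
  -- brings P₂⁽⁴⁾ to the form required for the test on (u, u²).
  have hX' : X₄ = totalD (fn f * jet 3 + fn h * (jet 1 * jet 2) +
      fn ((1 / 3 : ℝ) • (i - derivFun h)) * jet 1 ^ 3) := by
    have h5 : fn g = fn h + fn (derivFun f) := by rw [← fn_add, hh, sub_add_cancel]
    have h6 : fn j = (1 / 3 : ℝ) • fn (derivFun (i - derivFun h)) := by
      rw [← fn_smul, ← hj, smul_smul]
      norm_num
    rw [hX, h5, h6]
    simp only [fn_sub, fn_smul, map_add, map_sub, Derivation.map_smul, Derivation.leibniz, smul_eq_mul,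
      pow_succ, pow_zero, one_mul, totalD_fn, totalD_jet, Nat.reduceAdd]
    algebra
  rw [map_pow, hp, h0, h2, h4, hX', schoutenField_add_quadratic rfl
    (lieDer_cubicField_deltaPrime _ _ _ _ rfl) (lieDer_secondOrderField_deltaPrime s)] at e3
  -- The coefficient of u_xxxx is 20 κ u_x².
  have h5 := congrArg (partialD 4) e3
  simp [partialD_jet, Derivation.leibniz, Derivation.leibniz_pow] at h5
  have h6 : fn (f + (2 : ℝ) • (s * derivFun s)) = fn 0 := by
    rw [fn_zero]
    exact jet_one_mul_cancel (jet_one_mul_cancel (by linear_combination h5))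
  have h7 := fn_injective h6
  linear_combination (norm := module) h7

/-! ## Derivatives of `1 / u_x` -/

lemma derivation_uxInv (d : Derivation ℝ DiffRat DiffRat) :
    d uxInv = -(d (jet 1) * uxInv ^ 2) := by
  have h1 := congrArg d jet_one_mul_uxInv
  rw [Derivation.leibniz, Derivation.map_one_eq_zero, smul_eq_mul, smul_eq_mul] at h1
  linear_combination uxInv * h1 - d uxInv * jet_one_mul_uxInv

lemma totalD_uxInv : totalD uxInv = -(jet 2 * uxInv ^ 2) := by
  rw [derivation_uxInv, totalD_jet]

lemma along_uxInv (v : DiffRat) : along v uxInv = -(totalD v * uxInv ^ 2) := by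
  rw [derivation_uxInv, along_jet, dPow_succ, dPow_zero]

/-- Obtained from the product rule applied to the constant u_x · (1/u_x) = 1, tested on f/u_x. -/
lemma frechetAdj_uxInv (f : DiffRat) : frechetAdj uxInv f = totalD (uxInv ^ 2 * f) := by
  have h1 : frechetAdj (jet 1 * uxInv) (uxInv * f) = 0 := by
    rw [jet_one_mul_uxInv, ← fn_one, frechetAdj_fn, Derivation.map_one_eq_zero, fn_zero, mul_zero]
  rw [frechetAdj_mul, frechetAdj_jet, ← mul_assoc (jet 1), jet_one_mul_uxInv, one_mul, ← mul_assoc] at h1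
  rw [pow_two]
  simp only [dPow_succ, dPow_zero, pow_one, neg_one_smul] at h1
  exact (neg_add_eq_zero.1 h1).symm

/-! ## Variational derivatives of the densities -/

lemma varDeriv_densityB (b : SmoothFun) : varDeriv (densityB b) =
    fn (derivFun b) * jet 2 * uxInv + fn (derivFun (derivFun b)) * jet 1 := by
  rw [densityB, varDeriv_eq_frechetAdj]
  simp only [map_add, map_neg, Derivation.leibniz, smul_eq_mul,
    frechetAdj_mul, frechetAdj_fn, frechetAdj_uxInv, pow_succ, pow_zero, one_mul, mul_one,
    frechetAdj_jet, dPow_succ, dPow_zero, totalD_fn, totalD_jet, totalD_uxInv, mul_neg_one, one_smul,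
    neg_neg, Nat.reduceAdd]
  -- Powers of u_x and of 1/u_x are independent for the normalizer, so the identity holds only
  -- modulo u_x · (1/u_x) = 1. The multiplier is the quotient in this reduction; the same device
  -- recurs below.
  linear_combination (norm := algebra) (fn (derivFun (derivFun b)) * jet 1 -
    uxInv * fn (derivFun b) * jet 2) * jet_one_mul_uxInv

lemma varDeriv_fn_mul_sq (μ : SmoothFun) : varDeriv (fn μ * jet 2 ^ 2 * uxInv) =
      (2 : ℝ) • (uxInv * fn μ * jet 4) - (4 : ℝ) • (uxInv ^ 2 * fn μ * (jet 2 * jet 3)) +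
      (2 : ℝ) • (uxInv ^ 3 * fn μ * jet 2 ^ 3) + (4 : ℝ) • (fn (derivFun μ) * jet 3) +
      (2 : ℝ) • (fn (derivFun (derivFun μ)) * (jet 1 * jet 2)) := by
  rw [varDeriv_eq_frechetAdj]
  simp only [map_add, map_neg, Derivation.leibniz, smul_eq_mul,
    frechetAdj_mul, frechetAdj_fn, frechetAdj_uxInv, pow_succ, pow_zero, one_mul, mul_one,
    frechetAdj_jet, dPow_succ, dPow_zero, totalD_fn, totalD_jet, totalD_uxInv, mul_neg_one, one_smul,
    neg_neg, Nat.reduceAdd]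
  linear_combination (norm := algebra)
    (-((3 : ℝ) • (uxInv * fn (derivFun μ) * jet 2 ^ 2)) + (4 : ℝ) • (fn (derivFun μ) * jet 3) +
      (2 : ℝ) • (fn (derivFun (derivFun μ)) * (jet 1 * jet 2))) * jet_one_mul_uxInv

lemma varDeriv_fn_mul_cube (ν : SmoothFun) : varDeriv (fn ν * jet 2 ^ 3 * uxInv ^ 3) =
      (3 : ℝ) • (uxInv * fn (derivFun (derivFun ν)) * jet 2 ^ 2) +
      (12 : ℝ) • (uxInv ^ 2 * fn (derivFun ν) * (jet 2 * jet 3)) +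
      (6 : ℝ) • (uxInv ^ 3 * fn ν * (jet 2 * jet 4)) + (6 : ℝ) • (uxInv ^ 3 * fn ν * jet 3 ^ 2) -
      (11 : ℝ) • (uxInv ^ 3 * fn (derivFun ν) * jet 2 ^ 3) -
      (36 : ℝ) • (uxInv ^ 4 * fn ν * (jet 2 ^ 2 * jet 3)) +
      (24 : ℝ) • (uxInv ^ 5 * fn ν * jet 2 ^ 4) := by
  rw [varDeriv_eq_frechetAdj]
  simp only [map_add, map_neg, Derivation.leibniz, smul_eq_mul,
    frechetAdj_mul, frechetAdj_fn, frechetAdj_uxInv, pow_succ, pow_zero, one_mul, mul_one,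
    frechetAdj_jet, dPow_succ, dPow_zero, totalD_fn, totalD_jet, totalD_uxInv, mul_neg_one, one_smul,
    neg_neg, Nat.reduceAdd]
  linear_combination (norm := algebra)
      ((3 : ℝ) • (uxInv * fn (derivFun (derivFun ν)) * jet 2 ^ 2) +
      (12 : ℝ) • (uxInv ^ 2 * fn (derivFun ν) * (jet 2 * jet 3)) +
      (3 : ℝ) • (uxInv ^ 2 * fn (derivFun (derivFun ν)) * (jet 1 * jet 2 ^ 2)) -
      (15 : ℝ) • (uxInv ^ 3 * fn (derivFun ν) * jet 2 ^ 3)) * jet_one_mul_uxInv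

lemma varDeriv_densityRho {b b1 b2 b3 b4 : SmoothFun} (h1 : derivFun b = b1)
    (h2 : derivFun b1 = b2) (h3 : derivFun b2 = b3) (h4 : derivFun b3 = b4) :
    varDeriv (densityRho b) =
      (3 / 2 : ℝ) • (fn b1 * fn b2 * uxInv * jet 4) -
      (27 / 5 : ℝ) • (fn b1 * fn b2 * uxInv ^ 2 * (jet 2 * jet 3)) +
      (37 / 10 : ℝ) • (fn b1 * fn b2 * uxInv ^ 3 * jet 2 ^ 3) -
      (3 / 5 : ℝ) • (fn b1 * fn b3 * uxInv * jet 2 ^ 2) + (3 : ℝ) • (fn b1 * fn b3 * jet 3) +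
      (3 / 2 : ℝ) • (fn b1 * fn b4 * (jet 1 * jet 2)) -
      (3 / 5 : ℝ) • (fn b1 ^ 2 * uxInv ^ 3 * (jet 2 * jet 4)) -
      (3 / 5 : ℝ) • (fn b1 ^ 2 * uxInv ^ 3 * jet 3 ^ 2) +
      (18 / 5 : ℝ) • (fn b1 ^ 2 * uxInv ^ 4 * (jet 2 ^ 2 * jet 3)) -
      (12 / 5 : ℝ) • (fn b1 ^ 2 * uxInv ^ 5 * jet 2 ^ 4) +
      (9 / 2 : ℝ) • (fn b2 * fn b3 * (jet 1 * jet 2)) -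
      (3 / 5 : ℝ) • (fn b2 ^ 2 * uxInv * jet 2 ^ 2) + (3 : ℝ) • (fn b2 ^ 2 * jet 3) := by
  -- Integration by parts removes the term with u_xx u_xxx, leaving ¾ b'b'' u_xx²/u_x - (1/10)(b')²
  -- u_xx³/u_x³.
  have h5 : densityRho b = fn ((3 / 4 : ℝ) • (b1 * b2)) * jet 2 ^ 2 * uxInv +
      fn ((-1 / 10 : ℝ) • b1 ^ 2) * jet 2 ^ 3 * uxInv ^ 3 +
      totalD ((-3 / 4 : ℝ) • (fn b1 ^ 2 * jet 2 ^ 2 * uxInv ^ 2)) := by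
    simp only [densityRho, h1, h2, fn_mul, fn_smul, Derivation.map_smul, Derivation.leibniz,
      smul_eq_mul, totalD_fn, totalD_jet, totalD_uxInv, pow_succ, pow_zero, one_mul, Nat.reduceAdd]
    linear_combination (norm := algebra)
      ((3 / 2 : ℝ) • (fn b1 * fn b2 * uxInv * jet 2 ^ 2)) * jet_one_mul_uxInv
  rw [h5, varDeriv_add, varDeriv_add, varDeriv_totalD, varDeriv_fn_mul_sq, varDeriv_fn_mul_cube]
  simp only [map_add, Derivation.map_smul, Derivation.leibniz, smul_eq_mul, h2, h3, h4, pow_succ,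
    pow_zero, one_mul, fn_add, fn_mul, fn_smul]
  algebra

/-- The difference δ(uρ) - u δρ is free of explicit u. This is what makes d₂∫ρ - d₁∫uρ free of
explicit u. -/
lemma varDeriv_jet_zero_mul_densityRho {b b1 b2 b3 b4 : SmoothFun} (h1 : derivFun b = b1)
    (h2 : derivFun b1 = b2) (h3 : derivFun b2 = b3) (h4 : derivFun b3 = b4) :
    varDeriv (jet 0 * densityRho b) = jet 0 * varDeriv (densityRho b) + (
      -((6 / 5 : ℝ) • (fn b1 * fn b2 * uxInv * jet 2 ^ 2)) + (9 : ℝ) • (fn b1 * fn b2 * jet 3) +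
      (6 : ℝ) • (fn b1 * fn b3 * (jet 1 * jet 2)) + (3 / 2 : ℝ) • (fn b1 ^ 2 * uxInv * jet 4) -
      (21 / 5 : ℝ) • (fn b1 ^ 2 * uxInv ^ 2 * (jet 2 * jet 3)) +
      (13 / 5 : ℝ) • (fn b1 ^ 2 * uxInv ^ 3 * jet 2 ^ 3) +
      (6 : ℝ) • (fn b2 ^ 2 * (jet 1 * jet 2))) := by
  obtain ⟨v, hv, hv'⟩ : ∃ v : SmoothFun, fn v = jet 0 ∧ derivFun v = 1 := ⟨_, rfl, derivFun_id⟩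
  have h5 : jet 0 * densityRho b =
      fn ((3 / 4 : ℝ) • (v * b1 * b2) + (3 / 4 : ℝ) • b1 ^ 2) * jet 2 ^ 2 * uxInv +
      fn ((-1 / 10 : ℝ) • (v * b1 ^ 2)) * jet 2 ^ 3 * uxInv ^ 3 +
      totalD ((-3 / 4 : ℝ) • (jet 0 * fn b1 ^ 2 * jet 2 ^ 2 * uxInv ^ 2)) := by
    simp only [densityRho, h1, h2, hv, fn_add, fn_mul, fn_smul, Derivation.map_smul,
      Derivation.leibniz, smul_eq_mul, totalD_fn, totalD_jet, totalD_uxInv, pow_succ, pow_zero,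
      one_mul, Nat.reduceAdd]
    linear_combination (norm := algebra)
      ((3 / 2 : ℝ) • (fn b1 * fn b2 * uxInv * (jet 0 * jet 2 ^ 2)) +
        (3 / 4 : ℝ) • (fn b1 ^ 2 * uxInv * jet 2 ^ 2)) * jet_one_mul_uxInv
  rw [varDeriv_densityRho h1 h2 h3 h4, h5, varDeriv_add, varDeriv_add, varDeriv_totalD,
    varDeriv_fn_mul_sq, varDeriv_fn_mul_cube]
  simp only [map_add, Derivation.map_smul, Derivation.leibniz, smul_eq_mul, h2, h3, h4, hv, hv',
    pow_succ, pow_zero, one_mul, mul_one, fn_add, fn_mul, fn_smul,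
    add_zero]
  algebra

/-- The commutator of the two hamiltonian vector fields of a functional. -/
lemma vectorBracket_totalD_hydro (q : DiffRat) :
    vectorBracket (totalD q) (hydro (jet 0) q) = totalD q ^ 2 +
      (1 / 2 : ℝ) • (q * totalD (totalD q)) - (1 / 2 : ℝ) • (jet 1 * along (totalD q) q) -
      totalD (along (hydro (jet 0) q) q - jet 0 * along (totalD q) q) := by
  simp only [vectorBracket, along_totalD, hydro_apply, map_add, map_sub, Derivation.map_smul,
    Derivation.leibniz, smul_eq_mul, along_jet, dPow_succ, dPow_zero, totalD_jet, along_totalD,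
    Nat.reduceAdd]
  algebra

lemma along_totalD_varDeriv {q : DiffRat} {b1 b2 b3 b4 b5 : SmoothFun}
    (hq : q = fn b1 * jet 2 * uxInv + fn b2 * jet 1)
    (h2 : derivFun b1 = b2) (h3 : derivFun b2 = b3) (h4 : derivFun b3 = b4)
    (h5 : derivFun b4 = b5) :
    along (totalD q) q =
      (5 : ℝ) • (fn b1 * fn b2 * uxInv * jet 4) -
      (10 : ℝ) • (fn b1 * fn b2 * uxInv ^ 2 * (jet 2 * jet 3)) +
      (5 : ℝ) • (fn b1 * fn b2 * uxInv ^ 3 * jet 2 ^ 3) -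
      (2 : ℝ) • (fn b1 * fn b3 * uxInv * jet 2 ^ 2) + (8 : ℝ) • (fn b1 * fn b3 * jet 3) +
      (6 : ℝ) • (fn b1 * fn b4 * (jet 1 * jet 2)) + fn b1 * fn b5 * jet 1 ^ 3 +
      fn b1 ^ 2 * uxInv ^ 2 * jet 5 - (5 : ℝ) • (fn b1 ^ 2 * uxInv ^ 3 * (jet 2 * jet 4)) -
      (3 : ℝ) • (fn b1 ^ 2 * uxInv ^ 3 * jet 3 ^ 2) +
      (15 : ℝ) • (fn b1 ^ 2 * uxInv ^ 4 * (jet 2 ^ 2 * jet 3)) -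
      (8 : ℝ) • (fn b1 ^ 2 * uxInv ^ 5 * jet 2 ^ 4) +
      (7 : ℝ) • (fn b2 * fn b3 * (jet 1 * jet 2)) + fn b2 * fn b4 * jet 1 ^ 3 +
      fn b2 ^ 2 * uxInv * jet 2 ^ 2 + (3 : ℝ) • (fn b2 ^ 2 * jet 3) + fn b3 ^ 2 * jet 1 ^ 3 := by
  subst hq
  simp only [map_add, map_neg, Derivation.leibniz, smul_eq_mul,
    totalD_fn, totalD_jet, totalD_uxInv, along_fn, along_jet, along_uxInv, dPow_succ, dPow_zero,
    h2, h3, h4, h5, pow_succ, pow_zero, one_mul, Nat.reduceAdd]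
  linear_combination (norm := algebra) (
      (3 : ℝ) • (fn b1 * fn b2 * uxInv * jet 4) -
      (11 : ℝ) • (fn b1 * fn b2 * uxInv ^ 2 * (jet 2 * jet 3)) +
      (8 : ℝ) • (fn b1 * fn b2 * uxInv ^ 3 * jet 2 ^ 3) +
      (3 : ℝ) • (fn b1 * fn b3 * uxInv * (jet 1 * jet 3)) -
      (5 : ℝ) • (fn b1 * fn b3 * uxInv * jet 2 ^ 2) -
      (4 : ℝ) • (fn b1 * fn b3 * uxInv ^ 2 * (jet 1 * jet 2 ^ 2)) +
      (8 : ℝ) • (fn b1 * fn b3 * jet 3) + (6 : ℝ) • (fn b1 * fn b4 * (jet 1 * jet 2)) +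
      fn b1 * fn b5 * jet 1 ^ 3 + (3 : ℝ) • (fn b2 * fn b3 * (jet 1 * jet 2)) -
      fn b2 ^ 2 * uxInv * jet 2 ^ 2 + (2 : ℝ) • (fn b2 ^ 2 * jet 3)) * jet_one_mul_uxInv

/-- Subtracting u times the derivative along ∂q removes the explicit u and lowers the order; this is
the combination that occurs in the commutator of the two hamiltonian fields of q. -/
lemma along_hydro_varDeriv {q : DiffRat} {b1 b2 b3 b4 b5 : SmoothFun}
    (hq : q = fn b1 * jet 2 * uxInv + fn b2 * jet 1)
    (h2 : derivFun b1 = b2) (h3 : derivFun b2 = b3) (h4 : derivFun b3 = b4)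
    (h5 : derivFun b4 = b5) :
    along (hydro (jet 0) q) q - jet 0 * along (totalD q) q =
      -((5 / 2 : ℝ) • (fn b1 * fn b2 * uxInv * jet 2 ^ 2)) +
      (19 / 2 : ℝ) • (fn b1 * fn b2 * jet 3) + (11 : ℝ) • (fn b1 * fn b3 * (jet 1 * jet 2)) +
      (5 / 2 : ℝ) • (fn b1 * fn b4 * jet 1 ^ 3) + (5 / 2 : ℝ) • (fn b1 ^ 2 * uxInv * jet 4) -
      (13 / 2 : ℝ) • (fn b1 ^ 2 * uxInv ^ 2 * (jet 2 * jet 3)) +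
      (4 : ℝ) • (fn b1 ^ 2 * uxInv ^ 3 * jet 2 ^ 3) + (2 : ℝ) • (fn b2 * fn b3 * jet 1 ^ 3) +
      (4 : ℝ) • (fn b2 ^ 2 * (jet 1 * jet 2)) := by
  rw [along_totalD_varDeriv hq h2 h3 h4 h5]
  subst hq
  simp only [hydro_apply, map_add, map_neg, Derivation.map_smul, Derivation.leibniz, smul_eq_mul,
    totalD_fn, totalD_jet, totalD_uxInv, along_fn, along_jet, along_uxInv, dPow_succ, dPow_zero,
    h2, h3, h4, h5, pow_succ, pow_zero, one_mul, Nat.reduceAdd]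
  linear_combination (norm := algebra) (
      (3 : ℝ) • (fn b1 * fn b2 * uxInv * (jet 0 * jet 4)) +
      (5 : ℝ) • (fn b1 * fn b2 * uxInv * (jet 1 * jet 3)) -
      (5 : ℝ) • (fn b1 * fn b2 * uxInv * jet 2 ^ 2) -
      (11 : ℝ) • (fn b1 * fn b2 * uxInv ^ 2 * (jet 0 * jet 2 * jet 3)) -
      (13 / 2 : ℝ) • (fn b1 * fn b2 * uxInv ^ 2 * (jet 1 * jet 2 ^ 2)) +
      (8 : ℝ) • (fn b1 * fn b2 * uxInv ^ 3 * (jet 0 * jet 2 ^ 3)) +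
      (19 / 2 : ℝ) • (fn b1 * fn b2 * jet 3) +
      (3 : ℝ) • (fn b1 * fn b3 * uxInv * (jet 0 * jet 1 * jet 3)) -
      (5 : ℝ) • (fn b1 * fn b3 * uxInv * (jet 0 * jet 2 ^ 2)) +
      fn b1 * fn b3 * uxInv * (jet 1 ^ 2 * jet 2) -
      (4 : ℝ) • (fn b1 * fn b3 * uxInv ^ 2 * (jet 0 * jet 1 * jet 2 ^ 2)) +
      (8 : ℝ) • (fn b1 * fn b3 * (jet 0 * jet 3)) +
      (11 : ℝ) • (fn b1 * fn b3 * (jet 1 * jet 2)) +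
      (6 : ℝ) • (fn b1 * fn b4 * (jet 0 * jet 1 * jet 2)) +
      (5 / 2 : ℝ) • (fn b1 * fn b4 * jet 1 ^ 3) + fn b1 * fn b5 * (jet 0 * jet 1 ^ 3) +
      (5 / 2 : ℝ) • (fn b1 ^ 2 * uxInv * jet 4) -
      (9 : ℝ) • (fn b1 ^ 2 * uxInv ^ 2 * (jet 2 * jet 3)) +
      (13 / 2 : ℝ) • (fn b1 ^ 2 * uxInv ^ 3 * jet 2 ^ 3) +
      (3 : ℝ) • (fn b2 * fn b3 * (jet 0 * jet 1 * jet 2)) -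
      fn b2 ^ 2 * uxInv * (jet 0 * jet 2 ^ 2) + (2 : ℝ) • (fn b2 ^ 2 * (jet 0 * jet 3)) +
      (2 : ℝ) • (fn b2 ^ 2 * (jet 1 * jet 2))) * jet_one_mul_uxInv

lemma varDeriv_fn_mul_jet_one_cube (a : SmoothFun) : varDeriv (fn a * jet 1 ^ 3) =
    -((2 : ℝ) • (fn (derivFun a) * jet 1 ^ 3)) - (6 : ℝ) • (fn a * (jet 1 * jet 2)) := by
  rw [varDeriv_eq_frechetAdj]
  simp only [Derivation.leibniz, smul_eq_mul,
    frechetAdj_mul, frechetAdj_fn, pow_succ, pow_zero, one_mul, mul_one,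
    frechetAdj_jet, dPow_succ, dPow_zero, totalD_fn, totalD_jet, mul_neg_one, neg_smul, one_smul,
    Nat.reduceAdd]
  algebra

/-- The coefficients of ρ make every power of 1/u_x and the fifth derivative of u cancel against the
commutator of the hamiltonian fields of B, so the result is a differential polynomial. The
polynomial corrections a u_x³ and c u_x³ enter through c and w = a + uc only. -/
lemma hamField_eliminant {b b1 b2 b3 b4 b5 w c a : SmoothFun} (h1 : derivFun b = b1)
    (h2 : derivFun b1 = b2) (h3 : derivFun b2 = b3) (h4 : derivFun b3 = b4)
    (h5 : derivFun b4 = b5) (ha : fn w = fn a + jet 0 * fn c) :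
    hamField deltaPrime (-(jet 0 * densityRho b) + fn a * jet 1 ^ 3) +
      hamField (hydro (jet 0)) (densityRho b + fn c * jet 1 ^ 3) -
      (1 / 2 : ℝ) • vectorBracket (hamField deltaPrime (densityB b))
        (hamField (hydro (jet 0)) (densityB b)) =
      -((9 / 2 : ℝ) • (fn b1 * fn b2 * jet 4)) -
      (21 / 4 : ℝ) • (fn b1 * fn b3 * (jet 1 * jet 3)) -
      (3 / 4 : ℝ) • (fn b1 * fn b3 * jet 2 ^ 2) +
      (15 / 4 : ℝ) • (fn b1 * fn b4 * (jet 1 ^ 2 * jet 2)) +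
      (3 / 2 : ℝ) • (fn b1 * fn b5 * jet 1 ^ 4) -
      (9 : ℝ) • (fn b2 * fn b3 * (jet 1 ^ 2 * jet 2)) +
      (9 / 4 : ℝ) • (fn b2 * fn b4 * jet 1 ^ 4) -
      (39 / 4 : ℝ) • (fn b2 ^ 2 * (jet 1 * jet 3)) - (21 / 4 : ℝ) • (fn b2 ^ 2 * jet 2 ^ 2) +
      (3 / 4 : ℝ) • (fn b3 ^ 2 * jet 1 ^ 4) + (9 : ℝ) • (fn c * (jet 1 ^ 2 * jet 2)) +
      (3 : ℝ) • (fn (derivFun c) * jet 1 ^ 4) - (6 : ℝ) • (fn w * (jet 1 * jet 3)) -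
      (12 : ℝ) • (fn (derivFun w) * (jet 1 ^ 2 * jet 2)) -
      (2 : ℝ) • (fn (derivFun (derivFun w)) * jet 1 ^ 4) - (6 : ℝ) • (fn w * jet 2 ^ 2) := by
  obtain ⟨v, hv, hv'⟩ : ∃ v : SmoothFun, fn v = jet 0 ∧ derivFun v = 1 := ⟨_, rfl, derivFun_id⟩
  have hw : a = w - v * c := fn_injective (by rw [fn_sub, fn_mul, ha, hv, add_sub_cancel_right])
  have hq := varDeriv_densityB b
  rw [h1, h2] at hq
  simp only [hamField, deltaPrime_apply]
  rw [vectorBracket_totalD_hydro, along_hydro_varDeriv hq h2 h3 h4 h5,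
    along_totalD_varDeriv hq h2 h3 h4 h5, hq]
  simp only [varDeriv_add, varDeriv_neg, varDeriv_jet_zero_mul_densityRho h1 h2 h3 h4,
    varDeriv_fn_mul_jet_one_cube]
  rw [varDeriv_densityRho h1 h2 h3 h4]
  subst hw
  simp only [hydro_apply, map_add, map_neg, map_sub, Derivation.map_smul, Derivation.leibniz,
    smul_eq_mul, totalD_fn, totalD_jet, totalD_uxInv, h2, h3, h4, h5, hv, hv', fn_add, fn_sub, fn_mul,
    mul_one, pow_succ, pow_zero, one_mul, Nat.reduceAdd]
  linear_combination (norm := algebra) (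
      (27 / 20 : ℝ) • (fn b1 * fn b2 * uxInv * (jet 2 * jet 3)) -
      (4 / 5 : ℝ) • (fn b1 * fn b2 * uxInv ^ 2 * jet 2 ^ 3) -
      (1 / 4 : ℝ) • (fn b1 * fn b2 * jet 4) +
      (3 / 4 : ℝ) • (fn b1 * fn b3 * uxInv * (jet 1 * jet 2 ^ 2)) -
      fn b1 * fn b3 * (jet 1 * jet 3) - (1 / 4 : ℝ) • (fn b1 * fn b3 * jet 2 ^ 2) -
      (1 / 4 : ℝ) • (fn b1 * fn b4 * (jet 1 ^ 2 * jet 2)) +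
      (1 / 4 : ℝ) • (fn b1 ^ 2 * uxInv * jet 5) -
      (19 / 20 : ℝ) • (fn b1 ^ 2 * uxInv ^ 2 * (jet 2 * jet 4)) -
      (9 / 20 : ℝ) • (fn b1 ^ 2 * uxInv ^ 2 * jet 3 ^ 2) +
      (39 / 20 : ℝ) • (fn b1 ^ 2 * uxInv ^ 3 * (jet 2 ^ 2 * jet 3)) -
      (4 / 5 : ℝ) • (fn b1 ^ 2 * uxInv ^ 4 * jet 2 ^ 4) -
      (5 / 4 : ℝ) • (fn b2 * fn b3 * (jet 1 ^ 2 * jet 2)) -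
      (1 / 2 : ℝ) • (fn b2 ^ 2 * (jet 1 * jet 3)) - (3 / 4 : ℝ) • (fn b2 ^ 2 * jet 2 ^ 2)) * jet_one_mul_uxInv

lemma derivFun_primitive (u₀ : ℝ) (s : SmoothFun) : derivFun (primitive u₀ s) = s := by
  ext x
  have hs : ContDiff ℝ ∞ s.1 := s.2
  exact (intervalIntegral.integral_hasDerivAt_right (hs.continuous.intervalIntegrable _ _)
    hs.continuous.stronglyMeasurable.stronglyMeasurableAtFilter hs.continuous.continuousAt).deriv

lemma algebraMap_C_mul_X_zero_pow (f : SmoothFun) (n : ℕ) :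
    algebraMap DiffPoly DiffRat (MvPolynomial.C f * MvPolynomial.X 0 ^ n) = fn f * jet 1 ^ n := by
  rw [map_mul, map_pow]
  rfl

lemma isWeightedHomogeneous_C_mul_X_zero_pow (f : SmoothFun) (n : ℕ) :
    (MvPolynomial.C f * MvPolynomial.X 0 ^ n : DiffPoly).IsWeightedHomogeneous jetDegree n := by
  simpa [jetDegree] using (MvPolynomial.isWeightedHomogeneous_C jetDegree f).mul
    ((MvPolynomial.isWeightedHomogeneous_X SmoothFun jetDegree 0).pow n)

/-- A field of degree four satisfying the constraints is generated by two local functionals, up to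
the commutator of two hamiltonian fields. -/
lemma exists_eq_hamField_add_hamField {s b f g h i j : SmoothFun} {X₄ : DiffRat}
    (hb : derivFun b = (-2 / 3 : ℝ) • s)
    (hX : X₄ = fn f * jet 4 + fn g * (jet 1 * jet 3) + fn h * jet 2 ^ 2 +
      fn i * (jet 1 ^ 2 * jet 2) + fn j * jet 1 ^ 4)
    (hf : f = (-2 : ℝ) • (s * derivFun s)) (hh : h = g - derivFun f)
    (hj : (3 : ℝ) • j = derivFun (i - derivFun h)) :
    ∃ a c : SmoothFun, X₄ =
      hamField deltaPrime (-(jet 0 * densityRho b) + fn a * jet 1 ^ 3) +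
        hamField (hydro (jet 0)) (densityRho b + fn c * jet 1 ^ 3) -
        (1 / 2 : ℝ) • vectorBracket (hamField deltaPrime (densityB b))
          (hamField (hydro (jet 0)) (densityB b)) := by
  obtain ⟨v, hv⟩ : ∃ v : SmoothFun, fn v = jet 0 := ⟨_, rfl⟩
  obtain ⟨b1, h1⟩ : ∃ b1, derivFun b = b1 := ⟨_, rfl⟩
  obtain ⟨b2, h2⟩ : ∃ b2, derivFun b1 = b2 := ⟨_, rfl⟩
  obtain ⟨b3, h3⟩ : ∃ b3, derivFun b2 = b3 := ⟨_, rfl⟩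
  obtain ⟨b4, h4⟩ : ∃ b4, derivFun b3 = b4 := ⟨_, rfl⟩
  obtain ⟨b5, h5⟩ : ∃ b5, derivFun b4 = b5 := ⟨_, rfl⟩
  -- The function w is solved from the coefficient of u_x u_xxx, and c below from that of u_x² u_xx.
  -- The three other coefficients then agree because of the constraints on f, h and j.
  obtain ⟨w, hw⟩ : ∃ w, w = (-1 / 6 : ℝ) • (g + (21 / 4 : ℝ) • (b1 * b3) +
    (39 / 4 : ℝ) • b2 ^ 2) := ⟨_, rfl⟩
  obtain ⟨c, hc⟩ : ∃ c, c = (1 / 9 : ℝ) • (i - (15 / 4 : ℝ) • (b1 * b4) + (9 : ℝ) • (b2 * b3) +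
    (12 : ℝ) • derivFun w) := ⟨_, rfl⟩
  refine ⟨w - v * c, c, ?_⟩
  rw [hamField_eliminant h1 h2 h3 h4 h5 (w := w) (by rw [fn_sub, fn_mul, hv]; ring), hX]
  have hs : s = (-3 / 2 : ℝ) • b1 := by
    rw [← h1, hb, smul_smul]
    norm_num
  have hf' : f = (-9 / 2 : ℝ) • (b1 * b2) := by
    rw [hf, hs, Derivation.map_smul, h2]
    algebra
  have hg' : g = (-21 / 4 : ℝ) • (b1 * b3) - (39 / 4 : ℝ) • b2 ^ 2 - (6 : ℝ) • w := by
    rw [hw]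
    module
  have hh' : h = (-3 / 4 : ℝ) • (b1 * b3) - (21 / 4 : ℝ) • b2 ^ 2 - (6 : ℝ) • w := by
    rw [hh, hf', hg']
    simp only [Derivation.map_smul, Derivation.leibniz, smul_eq_mul, h2, h3]
    algebra
  have hi' : i = (15 / 4 : ℝ) • (b1 * b4) - (9 : ℝ) • (b2 * b3) - (12 : ℝ) • derivFun w +
      (9 : ℝ) • c := by
    rw [hc]
    module
  have hj' : j = (3 / 2 : ℝ) • (b1 * b5) + (9 / 4 : ℝ) • (b2 * b4) + (3 / 4 : ℝ) • b3 ^ 2 -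
      (2 : ℝ) • derivFun (derivFun w) + (3 : ℝ) • derivFun c := by
    have h6 : j = (1 / 3 : ℝ) • derivFun (i - derivFun h) := by
      rw [← hj, smul_smul]
      norm_num
    rw [h6, hi', hh']
    simp only [map_add, map_sub, pow_two, Derivation.map_smul, Derivation.leibniz, smul_eq_mul, h2,
      h3, h4, h5]
    algebra
  rw [hj', hi', hh', hg', hf']
  simp only [fn_add, fn_sub, fn_mul, fn_smul, fn_pow]
  algebra

/-! ## The two infinitesimal eliminations -/

/-- X⁽²⁾ differs from d₂B by d₁ of the functional of the same shape whose coefficient has derivative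
u b', and d₁ kills that difference. Only this derivative matters, so the base point of the primitive
is immaterial. -/
lemma lieDer_secondOrderField {s b : SmoothFun} (hb : derivFun b = (-2 / 3 : ℝ) • s) :
    lieDer (secondOrderField s) deltaPrime =
      lieDer (hydro (jet 0) (varDeriv (densityB b))) deltaPrime := by
  obtain ⟨v, hv, hv'⟩ : ∃ v : SmoothFun, fn v = jet 0 ∧ derivFun v = 1 := ⟨_, rfl, derivFun_id⟩
  have hs : s = (-3 / 2 : ℝ) • derivFun b := by
    rw [hb, smul_smul]
    norm_num
  have h1 : secondOrderField s = hydro (jet 0) (varDeriv (densityB b)) -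
      totalD (varDeriv (densityB (primitive 0 (v * derivFun b)))) := by
    rw [varDeriv_densityB, varDeriv_densityB, derivFun_primitive, hs, secondOrderField]
    simp only [fn_add, fn_mul, fn_smul, hv, hv', hydro_apply, map_add, Derivation.map_smul,
      Derivation.leibniz, smul_eq_mul, totalD_fn, totalD_jet, totalD_uxInv, pow_succ, pow_zero,
      one_mul, mul_one, Nat.reduceAdd]
    linear_combination (norm := algebra)
      ((1 / 2 : ℝ) • (fn (derivFun b) * jet 2)) * jet_one_mul_uxInv
  rw [h1, lieDer_sub, lieDer_totalD_deltaPrime (isClosedCovector_varDeriv _), sub_zero]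

lemma lieDer_neg_totalD_varDeriv_deltaPrime (f : DiffRat) :
    lieDer (-totalD (varDeriv f)) deltaPrime = 0 := by
  rw [lieDer_neg, lieDer_totalD_deltaPrime (isClosedCovector_varDeriv f), neg_zero]

/-- Anticommutation of d₁ and d₂: this is how a rational d₁-hamiltonian field removes a bivector of
the form d₁d₂I. -/
lemma lieDer_neg_totalD_varDeriv_hydro (f : DiffRat) :
    lieDer (-totalD (varDeriv f)) (hydro (jet 0)) =
      lieDer (hydro (jet 0) (varDeriv f)) deltaPrime := by
  rw [lieDer_neg, lieDer_totalD_hydro (isClosedCovector_varDeriv f), neg_neg]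

/-- With V = d₁I and W = d₂I, the square is -Lie_V Lie_W P₁, and Lie_V P₁ = 0 makes Lie_V Lie_W P₁
equal to the Lie derivative along [V, W]. This is the source of the commutator in the formula for
X⁽⁴⁾. -/
lemma lieDer_lieDer_neg_totalD_varDeriv_hydro (f : DiffRat) :
    lieDer (-totalD (varDeriv f)) (lieDer (-totalD (varDeriv f)) (hydro (jet 0))) =
      -lieDer (vectorBracket (totalD (varDeriv f)) (hydro (jet 0) (varDeriv f))) deltaPrime := by
  rw [lieDer_neg_totalD_varDeriv_hydro, lieDer_vectorBracket,
    lieDer_totalD_deltaPrime (isClosedCovector_varDeriv f), lieDer_neg]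
  simp [lieDer]

/-- Applying d₁ to the decomposition of X⁽⁴⁾: the term d₁A disappears, d₂B' becomes the Lie
derivative of P₂⁽⁰⁾ along -d₁B', and the commutator becomes half the squared Lie derivative. -/
lemma lieDer_deltaPrime_of_eq_hamField {X₄ A B B' : DiffRat} (h : X₄ = hamField deltaPrime A +
    hamField (hydro (jet 0)) B' - (1 / 2 : ℝ) •
      vectorBracket (hamField deltaPrime B) (hamField (hydro (jet 0)) B)) :
    lieDer (-totalD (varDeriv B')) (hydro (jet 0)) = lieDer X₄ deltaPrime - (1 / 2 : ℝ) •
      lieDer (-totalD (varDeriv B)) (lieDer (-totalD (varDeriv B)) (hydro (jet 0))) := by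
  rw [lieDer_lieDer_neg_totalD_varDeriv_hydro, lieDer_neg_totalD_varDeriv_hydro, h, lieDer_sub,
    lieDer_add, lieDer_smul]
  simp only [hamField, deltaPrime_apply]
  rw [lieDer_totalD_deltaPrime (isClosedCovector_varDeriv A)]
  module

/-! ## The finite transformations -/

/-- The transformation `ū = u + ε² X + ε⁴ (½ X(X) + Y)` eliminates the terms of order two, and changes
the terms of order four by a Lie derivative. -/
lemma bringsTo_of_lieDer_eq {X Y : DiffRat} {F : ℕ → DiffRat} (h0 : F 0 = jet 0) (h1 : F 1 = 0)
    (h2 : F 2 = X) (h3 : F 3 = 0) (h4 : F 4 = (1 / 2 : ℝ) • along X X + Y) {P₁ P₂ : ℕ → Bivector}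
    (hP₁ : ∀ n ≤ 4, P₁ n = if n = 0 then deltaPrime else 0) (hP₂_zero : P₂ 0 = hydro (jet 0))
    (hP₂_one : P₂ 1 = 0) (hP₂_three : P₂ 3 = 0) (hX : lieDer X deltaPrime = 0)
    (hY : lieDer Y deltaPrime = 0) (hXP : P₂ 2 = lieDer X (hydro (jet 0))) {Q : Bivector}
    (hQ : Q = P₂ 4 - (1 / 2 : ℝ) • lieDer X (lieDer X (hydro (jet 0))) -
      lieDer Y (hydro (jet 0))) : BringsTo 4 F P₁ P₂ Q := by
  have h10 := hP₁ 0 (by norm_num)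
  have h11 := hP₁ 1 (by norm_num)
  have h12 := hP₁ 2 (by norm_num)
  have h13 := hP₁ 3 (by norm_num)
  have h14 := hP₁ 4 (by norm_num)
  norm_num at h10 h11 h12 h13 h14
  obtain ⟨e0, e1, e2, e3, e4⟩ := pushforward_four X Y F h0 h1 h2 h3 h4 P₁ h11 h13
  obtain ⟨f0, f1, f2, f3, f4⟩ := pushforward_four X Y F h0 h1 h2 h3 h4 P₂ hP₂_one hP₂_three
  have hL0 : lieDer X 0 = 0 := by simp [lieDer]
  have g4 : hydro ((1 / 2 : ℝ) • along X X + Y) = (1 / 2 : ℝ) • hydro (along X X) + hydro Y := by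
    rw [hydro_add, hydro_smul]
  simp only [h10, h12, h14, alongEnd_mul_deltaPrime, hX, hY, hL0, mul_zero, zero_mul, sub_zero,
    add_zero, smul_zero] at e0 e2 e4
  -- Since P₂⁽²⁾ = Lie_X P₂⁽⁰⁾, the mixed commutator at order four vanishes, and ½Lie_X² - Lie_X²
  -- leaves -½Lie_X²; the other commutators assemble into hydro(F₄).
  simp only [hP₂_zero, alongEnd_mul_hydro, along_jet_zero, hXP, sub_self, mul_zero, zero_mul] at f2 f4
  intro n hn
  interval_cases n
  · exact ⟨by simpa using e0, by simp [f0, hP₂_zero, h0]⟩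
  · exact ⟨by simpa using e1, by simp [f1, h1, hydro_zero]⟩
  · exact ⟨by simpa using e2, by simp [f2, h2]⟩
  · exact ⟨by simpa using e3, by simp [f3, h3, hydro_zero]⟩
  · refine ⟨by simpa using e4, ?_⟩
    rw [f4, if_pos rfl, h4, g4, hQ]
    module

lemma expFlow_zero (m : ℕ) (X : DiffRat) : expFlow m X 0 = jet 0 := by simp [expFlow]

lemma expFlow_of_not_dvd {m n : ℕ} (h : ¬m ∣ n) (X : DiffRat) : expFlow m X n = 0 := if_neg h

lemma expFlow_self {m : ℕ} (hm : 0 < m) (X : DiffRat) : expFlow m X m = X := by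
  simp [expFlow, Nat.div_self hm, along_jet_zero]

lemma expFlow_two_four (X : DiffRat) : expFlow 2 X 4 = (1 / 2 : ℝ) • along X X := by
  have h1 : (2 : ℕ) ∣ 4 := by norm_num
  rw [expFlow, if_pos h1]
  simp [pow_two, along_jet_zero]

/-- The densities of the local functionals that eliminate the deformation. -/
lemma exists_eliminant {s b : SmoothFun} {X₄ : DiffPoly}
    (hb : derivFun b = (-2 / 3 : ℝ) • s) (hX₄ : X₄.IsWeightedHomogeneous jetDegree 4)
    {P : ℕ → Bivector} (h0 : P 0 = hydro (jet 0)) (h1 : P 1 = 0)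
    (h2 : P 2 = lieDer (secondOrderField s) deltaPrime) (h3 : P 3 = 0)
    (h4 : P 4 = lieDer (algebraMap DiffPoly DiffRat X₄) deltaPrime) (hP : SchoutenVanishes 4 P P) :
    ∃ α β : DiffPoly, α.IsWeightedHomogeneous jetDegree 3 ∧ β.IsWeightedHomogeneous jetDegree 3 ∧
      algebraMap DiffPoly DiffRat X₄ =
        hamField deltaPrime (-(jet 0 * densityRho b) + algebraMap DiffPoly DiffRat α) +
          hamField (hydro (jet 0)) (densityRho b + algebraMap DiffPoly DiffRat β) -
          (1 / 2 : ℝ) • vectorBracket (hamField deltaPrime (densityB b))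
            (hamField (hydro (jet 0)) (densityB b)) := by
  obtain ⟨f, g, h, i, j, hX⟩ := exists_eq_of_isWeightedHomogeneous_four hX₄
  obtain ⟨hf, hh, hj⟩ := constraints_of_schoutenVanishes hX h0 h1 h2 h3 h4 hP
  obtain ⟨a, c, e⟩ := exists_eq_hamField_add_hamField hb hX hf hh hj
  exact ⟨_, _, isWeightedHomogeneous_C_mul_X_zero_pow a 3, isWeightedHomogeneous_C_mul_X_zero_pow c 3,
    by rwa [algebraMap_C_mul_X_zero_pow, algebraMap_C_mul_X_zero_pow]⟩

lemma hasIntDegree_neg_totalD_varDeriv {f : DiffRat} {k : ℤ} (hf : HasIntDegree f k) :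
    HasIntDegree (-totalD (varDeriv f)) (k + 1) :=
  hf.varDeriv.totalD.neg

end LoopSpace

theorem theorem8 (s : SmoothFun) (X₄ : DiffPoly)
    (hX₄ : X₄.IsWeightedHomogeneous jetDegree 4)
    (P₁ P₂ : ℕ → Bivector)
    (hP₁ : ∀ n ≤ 4, P₁ n = if n = 0 then deltaPrime else 0)
    (hP₂_zero : P₂ 0 = hydro (jet 0))
    (hP₂_one : P₂ 1 = 0)
    (hP₂_two : P₂ 2 = lieDer (secondOrderField s) deltaPrime)
    (hP₂_three : P₂ 3 = 0)
    (hP₂_four : P₂ 4 = lieDer (algebraMap DiffPoly DiffRat X₄) deltaPrime)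
    (hdef : IsDeformation 4 P₁ P₂) :
    IsQuasiTrivial 4 P₁ P₂ ∧
    ∀ (u₀ : ℝ) (b : SmoothFun), b = (-2 / 3 : ℝ) • primitive u₀ s →
      ∃ α β : DiffPoly, α.IsWeightedHomogeneous jetDegree 3 ∧
        β.IsWeightedHomogeneous jetDegree 3 ∧
        let B : DiffRat := densityB b
        let A' : DiffRat := -(jet 0 * densityRho b) + algebraMap DiffPoly DiffRat α
        let B' : DiffRat := densityRho b + algebraMap DiffPoly DiffRat β
        let X : DiffRat := -hamField (P₁ 0) B
        let Y : DiffRat := -hamField (P₁ 0) B'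
        let R : Bivector := P₂ 4 - (1 / 2 : ℝ) • lieDer X (lieDer X (P₂ 0))
        (algebraMap DiffPoly DiffRat X₄ = hamField (P₁ 0) A' + hamField (P₂ 0) B' -
          (1 / 2 : ℝ) • vectorBracket (hamField (P₁ 0) B) (hamField (P₂ 0) B)) ∧
        (lieDer X (P₁ 0) = 0 ∧ lieDer X (P₂ 0) = P₂ 2) ∧
        (lieDer Y (P₁ 0) = 0 ∧ lieDer Y (P₂ 0) = R) ∧
        (IsQuasiMiura (expFlow 2 X) ∧ BringsTo 4 (expFlow 2 X) P₁ P₂ R) ∧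
        (IsQuasiMiura (expFlow 4 Y) ∧
          BringsTo 4 (expFlow 4 Y) P₁
            (fun n => if n = 0 then P₂ 0 else if n = 4 then R else 0) 0) := by
  have hP₁_zero : P₁ 0 = deltaPrime := hP₁ 0 (by norm_num)
  have hb (u₀ : ℝ) : derivFun ((-2 / 3 : ℝ) • primitive u₀ s) = (-2 / 3 : ℝ) • s := by
    rw [Derivation.map_smul, derivFun_primitive]
  constructor
  · obtain ⟨α, β, hα, hβ, e⟩ := exists_eliminant (hb 0) hX₄ hP₂_zero hP₂_one hP₂_two hP₂_three
      hP₂_four hdef.2.1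
    set B := densityB ((-2 / 3 : ℝ) • primitive 0 s)
    set B' := densityRho ((-2 / 3 : ℝ) • primitive 0 s) + algebraMap DiffPoly DiffRat β
    obtain ⟨X, hX⟩ : ∃ X, X = -totalD (varDeriv B) := ⟨_, rfl⟩
    obtain ⟨Y, hY⟩ : ∃ Y, Y = -totalD (varDeriv B') := ⟨_, rfl⟩
    have hXd : HasIntDegree X 2 := hX ▸ hasIntDegree_neg_totalD_varDeriv (hasIntDegree_densityB _)
    have hYd : HasIntDegree Y 4 := hY ▸ hasIntDegree_neg_totalD_varDeriv
      ((hasIntDegree_densityRho _).add (hasIntDegree_algebraMap hβ))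
    -- The flow exp(ε²X) followed by exp(ε⁴Y), truncated after ε⁴.
    obtain ⟨F, hF⟩ : ∃ F : ℕ → DiffRat, ∀ n, F n = if n = 0 then jet 0 else if n = 2 then X else
      if n = 4 then (1 / 2 : ℝ) • along X X + Y else 0 := ⟨_, fun _ => rfl⟩
    refine ⟨F, ⟨fun k => HasIntDegree.hasDegree ?_, ?_⟩, bringsTo_of_lieDer_eq
      (X := X) (Y := Y) (hF 0) (hF 1) (hF 2) (hF 3) (hF 4) hP₁ hP₂_zero hP₂_one hP₂_three
      ?_ ?_ ?_ ?_⟩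
    · rw [hF]
      split_ifs with h0 h2 h4
      · exact h0 ▸ hasIntDegree_jet 0
      · exact h2 ▸ hXd
      · exact h4 ▸ ((hXd.along hXd).smul _).add hYd
      · exact hasIntDegree_zero _
    · simp [hF, partialD_jet]
    · rw [hX, lieDer_neg_totalD_varDeriv_deltaPrime]
    · rw [hY, lieDer_neg_totalD_varDeriv_deltaPrime]
    · rw [hP₂_two, hX, lieDer_neg_totalD_varDeriv_hydro, lieDer_secondOrderField (hb 0)]
    · rw [hP₂_four, hX, hY, lieDer_deltaPrime_of_eq_hamField e, sub_self]
  · rintro u₀ b rfl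
    obtain ⟨α, β, hα, hβ, e⟩ := exists_eliminant (hb u₀) hX₄ hP₂_zero hP₂_one hP₂_two hP₂_three
      hP₂_four hdef.2.1
    refine ⟨α, β, hα, hβ, ?_⟩
    intro B A' B' X Y R
    have hX : X = -totalD (varDeriv B) := by simp only [X, hamField, hP₁_zero, deltaPrime_apply]
    have hY : Y = -totalD (varDeriv B') := by simp only [Y, hamField, hP₁_zero, deltaPrime_apply]
    have hXd : HasIntDegree X 2 := hX ▸ hasIntDegree_neg_totalD_varDeriv (hasIntDegree_densityB _)
    have hYd : HasIntDegree Y 4 := hY ▸ hasIntDegree_neg_totalD_varDeriv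
      ((hasIntDegree_densityRho _).add (hasIntDegree_algebraMap hβ))
    have hR : R = P₂ 4 - (1 / 2 : ℝ) • lieDer X (lieDer X (hydro (jet 0))) := by
      simp only [R, hP₂_zero]
    have hX₁ : lieDer X deltaPrime = 0 := by rw [hX, lieDer_neg_totalD_varDeriv_deltaPrime]
    have hY₁ : lieDer Y deltaPrime = 0 := by rw [hY, lieDer_neg_totalD_varDeriv_deltaPrime]
    have hX₂ : lieDer X (hydro (jet 0)) = P₂ 2 := by
      rw [hP₂_two, hX, lieDer_neg_totalD_varDeriv_hydro, lieDer_secondOrderField (hb u₀)]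
    have hY₂ : lieDer Y (hydro (jet 0)) = R := by
      rw [hR, hP₂_four, hX, hY, lieDer_deltaPrime_of_eq_hamField e]
    have hz (Q : Bivector) : lieDer 0 Q = 0 := by
      simpa using lieDer_smul 0 0 Q
    refine ⟨?_, ⟨?_, ?_⟩, ⟨?_, ?_⟩, ⟨isQuasiMiura_expFlow two_pos hXd, ?_⟩,
      ⟨isQuasiMiura_expFlow four_pos hYd, ?_⟩⟩
    · rw [hP₁_zero, hP₂_zero]
      exact e
    · rw [hP₁_zero, hX₁]
    · rw [hP₂_zero, hX₂]
    · rw [hP₁_zero, hY₁]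
    · rw [hP₂_zero, hY₂]
    -- The flow of ε²X is the case Y = 0 of the combined transformation.
    · exact bringsTo_of_lieDer_eq (X := X) (Y := 0) (expFlow_zero 2 X)
        (expFlow_of_not_dvd (by norm_num) X) (expFlow_self two_pos X)
        (expFlow_of_not_dvd (by norm_num) X) (by rw [expFlow_two_four, add_zero]) hP₁ hP₂_zero hP₂_one
        hP₂_three hX₁ (hz _) hX₂.symm (by rw [hR, hz, sub_zero])
    -- The flow of ε⁴Y is the case X = 0, applied to a deformation without a term of order two.
    · exact bringsTo_of_lieDer_eq (X := 0) (Y := Y)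
        (P₂ := fun n => if n = 0 then P₂ 0 else if n = 4 then R else 0) (expFlow_zero 4 Y)
        (expFlow_of_not_dvd (by norm_num) Y) (expFlow_of_not_dvd (by norm_num) Y)
        (expFlow_of_not_dvd (by norm_num) Y) (by simp [expFlow_self four_pos]) hP₁ hP₂_zero rfl rfl
        (hz _) hY₁ (hz _).symm (by simp [hz, hY₂])
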